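/- Let $q$ be a complex number with $|q|<1$, and write $(x;q)_n=\prod_{k=0}^{n-1}(1-xq^k)$, $(x;q)_\infty=\prod_{k=0}^{\infty}(1-xq^k)$ and $(x_1,\dots,x_j;q)_\infty=(x_1;q)_\infty\cdots(x_j;q)_\infty$. Let $a$ and $b$ be non-zero complex numbers such that $a^2q^n\neq 1$ and $b^2q^n\neq 1$ for all $n\in\mathbb{Z}$ (if $q=0$, this means $a^2\ne 1$ and $b^2\neq 1$). Then both series below converge absolutely, and $$\begin{aligned} & \sum_{n=0}^{\infty} \frac{q^{2n^2+3n+1}}{1-q^{2n+1}} \left[ b^{2n+1} - a^{2n+1} + \frac{1}{a^{2n+1}} - \frac{1}{b^{2n+1}} \right] \\ & - \frac{1}{2} \sum_{n=1}^{\infty} \frac{(-1)^n q^{n(n+1)/2} (q; q)_{2n-1}}{(q; q)_n} \left[\frac{(1-aq^{2n})(a; q)_n}{(1-a)(qa^2; q)_{2n}} a^{2n} - \frac{(1+aq^{2n})(-a; q)_n}{(1+a)(qa^2; q)_{2n}} a^{2n} \right. \\ & \quad - \frac{(1-bq^{2n})(b; q)_n}{(1-b)(qb^2; q)_{2n}}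 b^{2n} + \frac{(1+bq^{2n})(-b; q)_n}{(1+b)(qb^2; q)_{2n}} b^{2n} \\ & \quad - \frac{(1-q^{2n}/a)(1/a; q)_n}{(1-1/a)(q/a^2; q)_{2n}} a^{-2n} + \frac{(1+q^{2n}/a)(-1/a; q)_n}{(1+1/a)(q/a^2; q)_{2n}} a^{-2n} \\ & \quad \left. + \frac{(1-q^{2n}/b)(1/b; q)_n}{(1-1/b)(q/b^2; q)_{2n}} b^{-2n} - \frac{(1+q^{2n}/b)(-1/b; q)_n}{(1+1/b)(q/b^2; q)_{2n}} b^{-2n} \right] \\ & = \frac{(a-b)(1+ab)}{(1-a^2)(1-b^2)} - a\, \frac{(b/a,\, qa/b,\, -ab,\, -q/(ab);\, q)_{\infty}\, (q^2, q^2; q^2)_{\infty}}{(a^2,\, q^2/a^2,\, b^2,\, q^2/b^2;\, q^2)_{\infty}}. \end{aligned}$$ -/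

import Mathlib

/-- The finite `q`-shifted factorial `(x; q)_n = (1 - x)(1 - xq) ⋯ (1 - xq^(n-1))`. -/
noncomputable def qPoch (x q : ℂ) (n : ℕ) : ℂ :=
  ∏ k ∈ Finset.range n, (1 - x * q ^ k)

/-- The infinite `q`-shifted factorial `(x; q)_∞ = (1 - x)(1 - xq)(1 - xq^2) ⋯`. -/
noncomputable def qPochInf (x q : ℂ) : ℂ :=
  ∏' k : ℕ, (1 - x * q ^ k)

/-- For `|q| < 1` the infinite product `(x; q)_∞` converges, to the limit of the `(x; q)_n`. -/
theorem tendsto_qPoch_qPochInf (x : ℂ) {q : ℂ} (hq : ‖q‖ < 1) :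
    Filter.Tendsto (qPoch x q) Filter.atTop (nhds (qPochInf x q)) := by
  have hs : Summable fun k : ℕ => ‖-(x * q ^ k)‖ := by
    simp only [norm_neg, norm_mul, norm_pow]
    exact (summable_geometric_of_lt_one (norm_nonneg q) hq).mul_left _
  have hm : Multipliable fun k : ℕ => 1 - x * q ^ k := by
    simpa [sub_eq_add_neg] using multipliable_one_add_of_summable hs
  exact hm.hasProd.tendsto_prod_nat

/-- The term of index `n` (`n ≥ 0`) of the Lambert-type series. -/
noncomputable def lambertTerm (a b q : ℂ) (n : ℕ) : ℂ :=
  q ^ (2 * n ^ 2 + 3 * n + 1) / (1 - q ^ (2 * n + 1)) *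
    (b ^ (2 * n + 1) - a ^ (2 * n + 1) + 1 / a ^ (2 * n + 1) - 1 / b ^ (2 * n + 1))

/-- The term of index `n` (`n ≥ 1`) of the well-poised series. -/
noncomputable def wellPoisedTerm (a b q : ℂ) (n : ℕ) : ℂ :=
  (-1) ^ n * q ^ (n * (n + 1) / 2) * qPoch q q (2 * n - 1) / qPoch q q n *
    ( (1 - a * q ^ (2 * n)) * qPoch a q n
        / ((1 - a) * qPoch (q * a ^ 2) q (2 * n)) * a ^ (2 * n)
    - (1 + a * q ^ (2 * n)) * qPoch (-a) q n
        / ((1 + a) * qPoch (q * a ^ 2) q (2 * n)) * a ^ (2 * n)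
    - (1 - b * q ^ (2 * n)) * qPoch b q n
        / ((1 - b) * qPoch (q * b ^ 2) q (2 * n)) * b ^ (2 * n)
    + (1 + b * q ^ (2 * n)) * qPoch (-b) q n
        / ((1 + b) * qPoch (q * b ^ 2) q (2 * n)) * b ^ (2 * n)
    - (1 - q ^ (2 * n) / a) * qPoch (1 / a) q n
        / ((1 - 1 / a) * qPoch (q / a ^ 2) q (2 * n)) * (1 / a ^ (2 * n))
    + (1 + q ^ (2 * n) / a) * qPoch (-1 / a) q n
        / ((1 + 1 / a) * qPoch (q / a ^ 2) q (2 * n)) * (1 / a ^ (2 * n))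
    + (1 - q ^ (2 * n) / b) * qPoch (1 / b) q n
        / ((1 - 1 / b) * qPoch (q / b ^ 2) q (2 * n)) * (1 / b ^ (2 * n))
    - (1 + q ^ (2 * n) / b) * qPoch (-1 / b) q n
        / ((1 + 1 / b) * qPoch (q / b ^ 2) q (2 * n)) * (1 / b ^ (2 * n)) )

open Filter Topology

/-! Everything reduces to one variable. Put S(x) = ∑ `halfTerm x q n`, B(x) = ∑ `bilateralTerm x q
n` and L(x) = ∑ `lambertHalfTerm x q n`. The well-poised series is a signed combination of S(x) -
S(-x) at x = a, b, 1/a, 1/b, and the heart of the proof is S(x) - S(-x) = 2(B(x) - L(x))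
(`tsum_halfTerm_sub_neg`). The Lambert series then cancel, and what remains is a difference of
bilateral sums ∑ x q^n / (1 - x² q^(2n)) at x = a and x = b, which is a theta quotient
(`thetaQuotient_eq_bilateralSum_sub`).

For S, a telescoping certificate gives S(x) - (1 - xq) S(xq) - xq S(xq²) as an explicit rational
function. The coefficients 1, -(1 - xq), -xq add up to 0, so T(x) = S(x) - S(xq) satisfies the first
order equation T(x) + xq T(xq) = rational. A rational function plus a partial theta function solves
it, and the solution is unique given its limit along x q^N (`tsum_halfTerm_sub_shift`). Its odd part
matches the shift difference of 2(B - L), and all the series vanish as x tends to 0.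

For the theta quotient, both sides are invariant under a ↦ aq and their poles in a cancel. The
difference therefore extends analytically to ℂ \ {0}, is constant by Liouville, and vanishes at a =
b. The case q = 0 is a rational identity. -/

/-! ### Finite q-shifted factorials and convergence tools -/

theorem qPoch_zero (x q : ℂ) : qPoch x q 0 = 1 := by simp [qPoch]

theorem qPoch_succ (x q : ℂ) (n : ℕ) : qPoch x q (n + 1) = qPoch x q n * (1 - x * q ^ n) := by
  simp [qPoch, Finset.prod_range_succ]

theorem qPoch_succ_left (x q : ℂ) (n : ℕ) :
    qPoch x q (n + 1) = (1 - x) * qPoch (x * q) q n := by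
  simp only [qPoch, Finset.prod_range_succ', pow_zero, mul_one, mul_comm (1 - x)]
  congr 1
  exact Finset.prod_congr rfl fun k _ => by ring

theorem qPoch_add (x q : ℂ) (m n : ℕ) :
    qPoch x q (m + n) = qPoch x q m * qPoch (x * q ^ m) q n := by
  simp only [qPoch, Finset.prod_range_add]
  congr 1
  exact Finset.prod_congr rfl fun k _ => by ring

theorem qPoch_ne_zero {x q : ℂ} (h : ∀ k : ℕ, x * q ^ k ≠ 1) (n : ℕ) : qPoch x q n ≠ 0 :=
  Finset.prod_ne_zero_iff.2 fun k _ => sub_ne_zero.2 (h k).symm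

theorem norm_qPoch_le (x : ℂ) {q : ℂ} (hq : ‖q‖ < 1) (n : ℕ) :
    ‖qPoch x q n‖ ≤ (1 + ‖x‖) ^ n := by
  rw [qPoch, norm_prod]
  refine (Finset.prod_le_prod (fun _ _ => norm_nonneg _) (g := fun _ => 1 + ‖x‖) ?_).trans (by simp)
  intro k _
  refine (norm_sub_le _ _).trans ?_
  rw [norm_one, norm_mul, norm_pow]
  gcongr
  exact mul_le_of_le_one_right (norm_nonneg _) (pow_le_one₀ (norm_nonneg _) hq.le)

theorem le_norm_qPoch {x q : ℂ} {m : ℝ} (hm : 0 ≤ m) (h : ∀ k : ℕ, m ≤ ‖1 - x * q ^ k‖) (n : ℕ) :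
    m ^ n ≤ ‖qPoch x q n‖ := by
  rw [qPoch, norm_prod]
  calc m ^ n = ∏ _k ∈ Finset.range n, m := by simp
    _ ≤ _ := Finset.prod_le_prod (fun _ _ => hm) fun k _ => h k

theorem pow_succ_ne_one {q : ℂ} (hq : ‖q‖ < 1) (n : ℕ) : q ^ (n + 1) ≠ 1 := fun h => by
  have h1 : ‖q ^ (n + 1)‖ < 1 := by
    rw [norm_pow]; exact pow_lt_one₀ (norm_nonneg _) hq (by omega)
  simp [h] at h1

theorem qPoch_self_ne_zero {q : ℂ} (hq : ‖q‖ < 1) (n : ℕ) : qPoch q q n ≠ 0 :=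
  qPoch_ne_zero (fun k => by rw [← pow_succ']; exact pow_succ_ne_one hq k) n

theorem tendsto_pow_mul_zero (x : ℂ) {q : ℂ} (hq : ‖q‖ < 1) :
    Tendsto (fun N : ℕ => x * q ^ N) atTop (𝓝 0) := by
  simpa using (tendsto_pow_atTop_nhds_zero_of_norm_lt_one hq).const_mul x

/-- The factors tend to 1 and none vanishes. Denominators (x; q)_n are thus at least m^n in norm, a
geometric loss that the quadratic power of q absorbs. -/
theorem exists_pos_le_norm_one_sub {x q : ℂ} (hq : ‖q‖ < 1) (h : ∀ k : ℕ, x * q ^ k ≠ 1) :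
    ∃ m : ℝ, 0 < m ∧ ∀ k : ℕ, m ≤ ‖1 - x * q ^ k‖ := by
  have ht : Tendsto (fun k : ℕ => ‖1 - x * q ^ k‖) atTop (𝓝 1) := by
    simpa using ((tendsto_pow_mul_zero x hq).const_sub 1).norm
  obtain ⟨N, hN⟩ := eventually_atTop.1 (ht.eventually (lt_mem_nhds (show (1 / 2 : ℝ) < 1 by norm_num)))
  have hfin : ∀ M : ℕ, ∃ m : ℝ, 0 < m ∧ ∀ k < M, m ≤ ‖1 - x * q ^ k‖ := by
    intro M
    induction M with
    | zero => exact ⟨1, one_pos, fun k hk => absurd hk (Nat.not_lt_zero k)⟩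
    | succ M ih =>
      obtain ⟨m, hm, hk⟩ := ih
      refine ⟨min m ‖1 - x * q ^ M‖,
        lt_min hm (norm_pos_iff.2 (sub_ne_zero.2 (h M).symm)), fun k hkM => ?_⟩
      rcases Nat.lt_succ_iff_lt_or_eq.1 hkM with h1 | rfl
      · exact (min_le_left _ _).trans (hk k h1)
      · exact min_le_right _ _
  obtain ⟨m, hm, hk⟩ := hfin N
  refine ⟨min m (1 / 2), lt_min hm (by norm_num), fun k => ?_⟩
  rcases lt_or_ge k N with h1 | h1
  · exact (min_le_left _ _).trans (hk k h1)
  · exact (min_le_right _ _).trans (hN k h1).le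

/-- A superlinear exponent beats any geometric growth: once K r^N < 1/2, the terms are eventually
below (1/2)^n. -/
theorem summable_pow_mul_pow {K r : ℝ} (hK : 0 ≤ K) (hr : 0 ≤ r) (hr1 : r < 1) {e : ℕ → ℕ}
    (he : ∀ N, ∀ᶠ n in atTop, N * n ≤ e n) : Summable fun n => K ^ n * r ^ e n := by
  have ht : Tendsto (fun N : ℕ => K * r ^ N) atTop (𝓝 0) := by
    simpa using (tendsto_pow_atTop_nhds_zero_of_lt_one hr hr1).const_mul K
  obtain ⟨N, hN⟩ := (ht.eventually (gt_mem_nhds (show (0 : ℝ) < 1 / 2 by norm_num))).exists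
  refine Summable.of_norm_bounded_eventually_nat
    (summable_geometric_of_lt_one (show (0 : ℝ) ≤ 1 / 2 by norm_num) (by norm_num)) ?_
  filter_upwards [he N] with n hn
  rw [Real.norm_of_nonneg (by positivity)]
  calc K ^ n * r ^ e n ≤ K ^ n * r ^ (N * n) := by
        gcongr ?_ * ?_
        exact pow_le_pow_of_le_one hr hr1.le hn
    _ = (K * r ^ N) ^ n := by rw [mul_pow, pow_mul]
    _ ≤ _ := pow_le_pow_left₀ (by positivity) hN.le n

theorem tendsto_tsum_nhds_zero {u : ℕ → ℂ → ℂ} {c : ℕ → ℝ} (hc : Summable c)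
    (h : ∀ n y, ‖y‖ ≤ 1 / 2 → ‖u n y‖ ≤ ‖y‖ * c n) :
    Tendsto (fun y => ∑' n, u n y) (𝓝 0) (𝓝 0) := by
  refine squeeze_zero_norm' (a := fun y : ℂ => ‖y‖ * ∑' n, c n) ?_ ?_
  · filter_upwards [Metric.closedBall_mem_nhds (0 : ℂ) (show (0 : ℝ) < 1 / 2 by norm_num)] with y hy
    rw [mem_closedBall_zero_iff] at hy
    exact tsum_of_norm_bounded (hc.hasSum.mul_left _) fun n => h n y hy
  · have : Tendsto (fun y : ℂ => ‖y‖ * ∑' n, c n) (𝓝 0) (𝓝 (‖(0 : ℂ)‖ * ∑' n, c n)) :=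
      (continuous_norm.mul continuous_const).tendsto 0
    simpa using this

/-- Norms that eventually increase yet tend to 0 must vanish; `hback` carries the zero down to index
0. This is the uniqueness principle for E(x) = -xq E(xq). -/
theorem eq_zero_of_norm_le_succ {e : ℕ → ℂ} (h0 : Tendsto e atTop (𝓝 0))
    (h : ∀ᶠ n in atTop, ‖e n‖ ≤ ‖e (n + 1)‖) (hback : ∀ n, e (n + 1) = 0 → e n = 0) : e 0 = 0 := by
  obtain ⟨N, hN⟩ := eventually_atTop.1 h
  have hmono : Monotone fun k => ‖e (N + k)‖ := monotone_nat_of_le_succ fun k => hN _ (by omega)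
  have hlim : Tendsto (fun k => ‖e (N + k)‖) atTop (𝓝 0) := by
    simpa using (h0.comp (tendsto_add_atTop_nat N)).norm.congr fun k => by simp [add_comm]
  have heN : e N = 0 := by
    have := hmono.ge_of_tendsto hlim 0
    simpa using this
  clear hlim hmono hN
  induction N with
  | zero => exact heN
  | succ N ih => exact ih (hback N heN)

theorem half_le_norm_one_sub {y q : ℂ} (hq : ‖q‖ < 1) (hy : ‖y‖ ≤ 1 / 2) (k : ℕ) :
    1 / 2 ≤ ‖1 - y * q ^ k‖ := by
  have h1 : ‖y * q ^ k‖ ≤ 1 / 2 := by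
    rw [norm_mul, norm_pow]
    exact (mul_le_of_le_one_right (norm_nonneg _) (pow_le_one₀ (norm_nonneg _) hq.le)).trans hy
  have := norm_sub_norm_le 1 (y * q ^ k)
  rw [norm_one] at this
  linarith

/-! ### The well-poised series and its q-recurrence -/

/-- The coefficient `(-1)^m q^(m(m+1)/2) (q; q)_(2m-1) / (q; q)_m` with `m = n + 1`. -/
noncomputable def wellPoisedCoeff (q : ℂ) (n : ℕ) : ℂ :=
  (-1) ^ (n + 1) * q ^ ((n + 1) * (n + 2) / 2) * qPoch q q (2 * n + 1) / qPoch q q (n + 1)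

/-- The term of index `n + 1` of the one-variable well-poised series. -/
noncomputable def halfTerm (x q : ℂ) (n : ℕ) : ℂ :=
  wellPoisedCoeff q n * (1 - x * q ^ (2 * (n + 1))) * qPoch (x * q) q n
    / qPoch (q * x ^ 2) q (2 * (n + 1)) * x ^ (2 * (n + 1))

/-- The telescoping certificate for the second order `q`-recurrence of `halfTerm`. -/
noncomputable def halfCert (x q : ℂ) (n : ℕ) : ℂ :=
  wellPoisedCoeff q n * x ^ (2 * (n + 1)) * qPoch (x * q) q n * (1 - q ^ (n + 1))
    * (-1 + (x ^ 2 * q - 1) * q ^ (n + 1)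
      + (x + x ^ 2 * q + x ^ 2 * q ^ 2 - x ^ 3 * q) * (q ^ (n + 1)) ^ 2
      + (x ^ 5 * q ^ 4 - x ^ 3 * q ^ 3) * (q ^ (n + 1)) ^ 3 - x ^ 6 * q ^ 4 * (q ^ (n + 1)) ^ 4)
    / qPoch (q * x ^ 2) q (2 * (n + 1) + 2)

theorem triangle_succ (n : ℕ) : (n + 1) * (n + 2) / 2 = n * (n + 1) / 2 + (n + 1) := by
  rw [show (n + 1) * (n + 2) = n * (n + 1) + (n + 1) * 2 by ring,
    Nat.add_mul_div_right _ _ two_pos]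

theorem wellPoisedCoeff_succ {q : ℂ} (hq : ‖q‖ < 1) (n : ℕ) :
    wellPoisedCoeff q (n + 1) * (1 - q * q ^ (n + 1)) =
      -(q * q ^ (n + 1)) * wellPoisedCoeff q n * (1 - (q ^ (n + 1)) ^ 2) *
        (1 - q * (q ^ (n + 1)) ^ 2) := by
  have h1 := qPoch_self_ne_zero hq (n + 1)
  have h2 : 1 - q * q ^ (n + 1) ≠ 0 := by
    rw [← pow_succ']; exact sub_ne_zero.2 (pow_succ_ne_one hq _).symm
  rw [wellPoisedCoeff, wellPoisedCoeff, show 2 * (n + 1) + 1 = 2 * n + 1 + 1 + 1 by ring,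
    qPoch_succ q q (2 * n + 1 + 1), qPoch_succ q q (2 * n + 1), qPoch_succ q q (n + 1),
    show n + 1 + 2 = (n + 1) + 1 + 1 by ring, triangle_succ (n + 1)]
  field_simp
  ring

theorem certificate_middle_aux {a B f1 f2 f3 f4 d1 d2 : ℂ} (c s A u X y : ℂ) (ha : a ≠ 0)
    (hf3 : f3 ≠ 0) (hf4 : f4 ≠ 0) :
    a * (c * s * (A * u / a) / (B * f1 * f2 / (d1 * d2)) * (X * y)) =
      c * A * X / (B * f1 * f2 * f3 * f4) * (y * s * u * d1 * d2 * f3 * f4) := by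
  field_simp

/-- The factors a = 1 - xq and b = 1 - xq² cancel because 1 - x²q² and 1 - x²q⁴ are differences of
squares. The term then has a polynomial numerator over the common denominator. -/
theorem certificate_last_aux {a b a' b' B f1 f2 f3 f4 d1 d3 : ℂ} (c s A u v w X y : ℂ)
    (ha : a ≠ 0) (hb : b ≠ 0) :
    w * (c * s * (A * u * v / (a * b)) /
      (B * f1 * f2 * f3 * f4 / (d1 * (a * a') * (d3 * (b * b')))) * (X * y)) =
      c * A * X / (B * f1 * f2 * f3 * f4) * (w * y * s * u * v * d1 * a' * d3 * b') := by
  have h : A * u * v / (a * b) * (d1 * (a * a') * (d3 * (b * b'))) =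
      A * u * v * d1 * a' * d3 * b' := by
    field_simp
  rw [div_div_eq_mul_div, mul_assoc (c * s), h]
  ring

/-- With Q standing for q^(n+1) and the factorials left as symbols tied by their contiguity
relations, the recurrence is an identity of rational functions. Over the common denominator it
becomes polynomial, hence `ring` decides it. -/
theorem wellPoised_certificate {x q Q : ℂ} (c c' A A' A'' X B B' B'' : ℂ)
    (h1 : 1 - x * q ≠ 0) (h2 : 1 - x * q ^ 2 ≠ 0) (hB : B ≠ 0)
    (e1 : 1 - x ^ 2 * q * Q ^ 2 ≠ 0) (e2 : 1 - x ^ 2 * q ^ 2 * Q ^ 2 ≠ 0)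
    (e3 : 1 - x ^ 2 * q ^ 3 * Q ^ 2 ≠ 0) (e4 : 1 - x ^ 2 * q ^ 4 * Q ^ 2 ≠ 0)
    (d1 : 1 - x ^ 2 * q ≠ 0) (d2 : 1 - x ^ 2 * q ^ 2 ≠ 0) (d3 : 1 - x ^ 2 * q ^ 3 ≠ 0)
    (d4 : 1 - x ^ 2 * q ^ 4 ≠ 0)
    (hc : c' * (1 - q * Q) = -(q * Q) * c * (1 - Q ^ 2) * (1 - q * Q ^ 2))
    (hA : (1 - x * q) * A' = A * (1 - x * Q)) (hA' : (1 - x * q ^ 2) * A'' = A' * (1 - x * q * Q))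
    (hB' : (1 - x ^ 2 * q) * (1 - x ^ 2 * q ^ 2) * B' =
      B * (1 - x ^ 2 * q * Q ^ 2) * (1 - x ^ 2 * q ^ 2 * Q ^ 2))
    (hB'' : (1 - x ^ 2 * q ^ 3) * (1 - x ^ 2 * q ^ 4) * B'' =
      B' * (1 - x ^ 2 * q ^ 3 * Q ^ 2) * (1 - x ^ 2 * q ^ 4 * Q ^ 2)) :
    c * (1 - x * Q ^ 2) * A / B * X
      - (1 - x * q) * (c * (1 - x * q * Q ^ 2) * A' / B' * (X * Q ^ 2))
      - x * q * (c * (1 - x * q ^ 2 * Q ^ 2) * A'' / B'' * (X * Q ^ 4)) =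
    c' * (X * x ^ 2) * (A * (1 - x * Q)) * (1 - q * Q)
        * (-1 + (x ^ 2 * q - 1) * (q * Q)
          + (x + x ^ 2 * q + x ^ 2 * q ^ 2 - x ^ 3 * q) * (q * Q) ^ 2
          + (x ^ 5 * q ^ 4 - x ^ 3 * q ^ 3) * (q * Q) ^ 3 - x ^ 6 * q ^ 4 * (q * Q) ^ 4)
        / (B * (1 - x ^ 2 * q * Q ^ 2) * (1 - x ^ 2 * q ^ 2 * Q ^ 2)
          * (1 - x ^ 2 * q ^ 3 * Q ^ 2) * (1 - x ^ 2 * q ^ 4 * Q ^ 2))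
      - c * X * A * (1 - Q)
        * (-1 + (x ^ 2 * q - 1) * Q
          + (x + x ^ 2 * q + x ^ 2 * q ^ 2 - x ^ 3 * q) * Q ^ 2
          + (x ^ 5 * q ^ 4 - x ^ 3 * q ^ 3) * Q ^ 3 - x ^ 6 * q ^ 4 * Q ^ 4)
        / (B * (1 - x ^ 2 * q * Q ^ 2) * (1 - x ^ 2 * q ^ 2 * Q ^ 2)) := by
  have EA : A' = A * (1 - x * Q) / (1 - x * q) := by rw [eq_div_iff h1, ← hA]; ring
  have EA' : A'' = A * (1 - x * Q) * (1 - x * q * Q) / ((1 - x * q) * (1 - x * q ^ 2)) := by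
    rw [eq_div_iff (mul_ne_zero h1 h2)]
    linear_combination (1 - x * q) * hA' + (1 - x * q * Q) * hA
  have EB : B' = B * (1 - x ^ 2 * q * Q ^ 2) * (1 - x ^ 2 * q ^ 2 * Q ^ 2)
      / ((1 - x ^ 2 * q) * (1 - x ^ 2 * q ^ 2)) := by
    rw [eq_div_iff (mul_ne_zero d1 d2), ← hB']; ring
  have EB' : B'' = B * (1 - x ^ 2 * q * Q ^ 2) * (1 - x ^ 2 * q ^ 2 * Q ^ 2)
      * (1 - x ^ 2 * q ^ 3 * Q ^ 2) * (1 - x ^ 2 * q ^ 4 * Q ^ 2)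
      / ((1 - x ^ 2 * q) * (1 - x ^ 2 * q ^ 2) * ((1 - x ^ 2 * q ^ 3) * (1 - x ^ 2 * q ^ 4))) := by
    rw [eq_div_iff (mul_ne_zero (mul_ne_zero d1 d2) (mul_ne_zero d3 d4))]
    linear_combination ((1 - x ^ 2 * q) * (1 - x ^ 2 * q ^ 2)) * hB'' +
      (1 - x ^ 2 * q ^ 3 * Q ^ 2) * (1 - x ^ 2 * q ^ 4 * Q ^ 2) * hB'
  have EC : c' * (X * x ^ 2) * (A * (1 - x * Q)) * (1 - q * Q) =
      -(q * Q) * c * (1 - Q ^ 2) * (1 - q * Q ^ 2) * (X * x ^ 2) * (A * (1 - x * Q)) := by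
    rw [← hc]; ring
  rw [EC, EA, EA', EB, EB']
  clear EC EA EA' EB EB' hA hA' hB' hB'' hc
  generalize hf1 : 1 - x ^ 2 * q * Q ^ 2 = f1 at *
  generalize hf2 : 1 - x ^ 2 * q ^ 2 * Q ^ 2 = f2 at *
  generalize hf3 : 1 - x ^ 2 * q ^ 3 * Q ^ 2 = f3 at *
  generalize hf4 : 1 - x ^ 2 * q ^ 4 * Q ^ 2 = f4 at *
  rw [certificate_middle_aux c _ A _ X _ h1 e3 e4,
    show 1 - x ^ 2 * q ^ 2 = (1 - x * q) * (1 + x * q) by ring,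
    show 1 - x ^ 2 * q ^ 4 = (1 - x * q ^ 2) * (1 + x * q ^ 2) by ring,
    certificate_last_aux c _ A _ _ (x * q) X _ h1 h2]
  have t1 : c * (1 - x * Q ^ 2) * A / B * X =
      c * A * X / (B * f1 * f2 * f3 * f4) * ((1 - x * Q ^ 2) * f1 * f2 * f3 * f4) := by
    field_simp
  rw [t1]
  have t5 : ∀ y : ℂ, c * X * A * (1 - Q) * y / (B * f1 * f2) =
      c * A * X / (B * f1 * f2 * f3 * f4) * ((1 - Q) * y * f3 * f4) := by
    intro y; field_simp
  rw [t5]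
  simp only [div_mul_eq_mul_div, ← sub_div]
  congr 1
  rw [← hf1, ← hf2, ← hf3, ← hf4]
  ring

/-- The quotient (q; q)_(2n+1) / (q; q)_(n+1) is a product of n factors, each of norm at most 2. -/
theorem norm_wellPoisedCoeff_le {q : ℂ} (hq : ‖q‖ < 1) (n : ℕ) :
    ‖wellPoisedCoeff q n‖ ≤ 2 ^ n * ‖q‖ ^ ((n + 1) * (n + 2) / 2) := by
  have h : wellPoisedCoeff q n =
      (-1) ^ (n + 1) * q ^ ((n + 1) * (n + 2) / 2) * qPoch (q * q ^ (n + 1)) q n := by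
    rw [wellPoisedCoeff, show 2 * n + 1 = n + 1 + n by ring, qPoch_add]
    field_simp [qPoch_self_ne_zero hq (n + 1)]
  rw [h, norm_mul, norm_mul, norm_pow, norm_pow, norm_neg, norm_one, one_pow, one_mul, mul_comm]
  gcongr
  refine (norm_qPoch_le _ hq n).trans ?_
  gcongr
  have : ‖q * q ^ (n + 1)‖ ≤ 1 := by
    rw [norm_mul, norm_pow]
    exact mul_le_one₀ hq.le (by positivity) (pow_le_one₀ (norm_nonneg _) hq.le)
  linarith

/-- The dependence on x is kept explicit: the same bound gives summability for fixed x and, through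
the leading ‖x‖², the limit 0 of the sum as x tends to 0. -/
theorem norm_halfTerm_le {x q : ℂ} (hq : ‖q‖ < 1) {m : ℝ} (hm : 0 < m)
    (h : ∀ k : ℕ, m ≤ ‖1 - q * x ^ 2 * q ^ k‖) (n : ℕ) :
    ‖halfTerm x q n‖ ≤ ‖x‖ ^ 2 * (1 + ‖x‖) / m ^ 2 *
      ((2 * (1 + ‖x‖) * ‖x‖ ^ 2 / m ^ 2) ^ n * ‖q‖ ^ ((n + 1) * (n + 2) / 2)) := by
  rw [halfTerm, norm_mul, norm_div, norm_mul, norm_mul, norm_pow]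
  have h1 : ‖1 - x * q ^ (2 * (n + 1))‖ ≤ 1 + ‖x‖ := by
    refine (norm_sub_le _ _).trans ?_
    rw [norm_one, norm_mul, norm_pow]
    gcongr
    exact mul_le_of_le_one_right (norm_nonneg _) (pow_le_one₀ (norm_nonneg _) hq.le)
  have h2 : ‖qPoch (x * q) q n‖ ≤ (1 + ‖x‖) ^ n := by
    refine (norm_qPoch_le _ hq n).trans ?_
    gcongr
    rw [norm_mul]
    exact mul_le_of_le_one_right (norm_nonneg _) hq.le
  calc _ ≤ 2 ^ n * ‖q‖ ^ ((n + 1) * (n + 2) / 2) * (1 + ‖x‖) * (1 + ‖x‖) ^ n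
        / m ^ (2 * (n + 1)) * ‖x‖ ^ (2 * (n + 1)) := by
        gcongr
        · exact norm_wellPoisedCoeff_le hq n
        · exact le_norm_qPoch hm.le h _
    _ = _ := by
        rw [div_pow, mul_pow, mul_pow, ← pow_mul, ← pow_mul, mul_add 2 n 1, pow_add, pow_add, mul_one]
        field_simp

theorem le_triangle (N : ℕ) : ∀ᶠ n in atTop, N * n ≤ (n + 1) * (n + 2) / 2 := by
  filter_upwards [eventually_ge_atTop (2 * N)] with n hn
  rw [Nat.le_div_iff_mul_le two_pos]
  nlinarith

theorem summable_norm_halfTerm {x q : ℂ} (hq : ‖q‖ < 1) (hx : ∀ k : ℕ, q * x ^ 2 * q ^ k ≠ 1) :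
    Summable fun n => ‖halfTerm x q n‖ := by
  obtain ⟨m, hm, h⟩ := exists_pos_le_norm_one_sub hq hx
  exact Summable.of_nonneg_of_le (fun _ => norm_nonneg _) (norm_halfTerm_le hq hm h)
    ((summable_pow_mul_pow (by positivity) (norm_nonneg _) hq le_triangle).mul_left _)

theorem tendsto_tsum_halfTerm {q : ℂ} (hq : ‖q‖ < 1) :
    Tendsto (fun y => ∑' n, halfTerm y q n) (𝓝 0) (𝓝 0) := by
  -- For ‖y‖ ≤ 1/2 and m = 1/2 the two constants of `norm_halfTerm_le` are at most 3‖y‖ and 3, so 8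
  -- and 16 are generous.
  refine tendsto_tsum_nhds_zero
    ((summable_pow_mul_pow (K := 16) (by norm_num) (norm_nonneg _) hq le_triangle).mul_left 8) ?_
  intro n y hy
  have hy2 : ‖q * y ^ 2‖ ≤ 1 / 2 := by
    rw [norm_mul, norm_pow]; nlinarith [norm_nonneg y, norm_nonneg q]
  refine (norm_halfTerm_le hq one_half_pos (half_le_norm_one_sub hq hy2) n).trans ?_
  have h0 := norm_nonneg y
  rw [← mul_assoc ‖y‖]
  gcongr
  · rw [div_le_iff₀ (by norm_num)]; nlinarith
  · rw [div_le_iff₀ (by norm_num)]; nlinarith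

theorem shift_ne_one {x q : ℂ} (hx : ∀ k : ℕ, q * x ^ 2 * q ^ k ≠ 1) (N k : ℕ) :
    q * (x * q ^ N) ^ 2 * q ^ k ≠ 1 := by
  have := hx (2 * N + k)
  rwa [show q * x ^ 2 * q ^ (2 * N + k) = q * (x * q ^ N) ^ 2 * q ^ k by ring] at this

theorem one_sub_mul_pow_ne_zero {x q : ℂ} (hx : ∀ k : ℕ, q * x ^ 2 * q ^ k ≠ 1) (k : ℕ) :
    1 - x * q ^ (k + 1) ≠ 0 := fun h => hx (2 * k + 1) <| by
  rw [sub_eq_zero] at h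
  calc q * x ^ 2 * q ^ (2 * k + 1) = (x * q ^ (k + 1)) ^ 2 := by ring
    _ = 1 := by rw [← h, one_pow]

theorem one_sub_sq_mul_pow_ne_zero {x q : ℂ} (hx : ∀ k : ℕ, q * x ^ 2 * q ^ k ≠ 1) (k : ℕ) :
    1 - x ^ 2 * q ^ (k + 1) ≠ 0 := fun h => hx k <| by
  rw [sub_eq_zero] at h
  rw [h]; ring

theorem halfTerm_recurrence {x q : ℂ} (hq : ‖q‖ < 1) (hx : ∀ k : ℕ, q * x ^ 2 * q ^ k ≠ 1)
    (n : ℕ) :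
    halfTerm x q n - (1 - x * q) * halfTerm (x * q) q n - x * q * halfTerm (x * q ^ 2) q n =
      halfCert x q (n + 1) - halfCert x q n := by
  have hd := one_sub_sq_mul_pow_ne_zero hx
  have he : ∀ i, 1 - x ^ 2 * q ^ (i + 1) * (q ^ (n + 1)) ^ 2 ≠ 0 := fun i => by
    have := hd (i + 2 * (n + 1))
    rwa [show x ^ 2 * q ^ (i + 2 * (n + 1) + 1) = x ^ 2 * q ^ (i + 1) * (q ^ (n + 1)) ^ 2 by ring]
      at this
  -- Both sides are (zq; q)_(n+1), with its first or its last factor split off.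
  have hA : ∀ z : ℂ, (1 - z * q) * qPoch (z * q * q) q n =
      qPoch (z * q) q n * (1 - z * q ^ (n + 1)) := fun z => by
    rw [← qPoch_succ_left, qPoch_succ, pow_succ']; ring
  have hB : ∀ z : ℂ, (1 - z * q) * (1 - z * q ^ 2) * qPoch (z * q ^ 3) q (2 * (n + 1)) =
      qPoch (z * q) q (2 * (n + 1)) * (1 - z * q * (q ^ (n + 1)) ^ 2) *
        (1 - z * q ^ 2 * (q ^ (n + 1)) ^ 2) := fun z => by
    have h1 := (qPoch_succ_left (z * q) q (2 * (n + 1) + 1)).symm.trans (qPoch_succ _ _ _)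
    have h2 := qPoch_succ (z * q) q (2 * (n + 1))
    have h3 := qPoch_succ_left (z * q * q) q (2 * (n + 1))
    rw [show z * q ^ 3 = z * q * q * q by ring]
    rw [h2, h3] at h1
    linear_combination h1
  have key := wellPoised_certificate (x := x) (q := q) (Q := q ^ (n + 1)) (wellPoisedCoeff q n)
    (wellPoisedCoeff q (n + 1)) (qPoch (x * q) q n) (qPoch (x * q * q) q n)
    (qPoch (x * q ^ 2 * q) q n) (x ^ (2 * (n + 1))) (qPoch (x ^ 2 * q) q (2 * (n + 1)))
    (qPoch (x ^ 2 * q ^ 3) q (2 * (n + 1))) (qPoch (x ^ 2 * q ^ 5) q (2 * (n + 1)))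
    (by simpa using one_sub_mul_pow_ne_zero hx 0) (one_sub_mul_pow_ne_zero hx 1)
    (qPoch_ne_zero (fun k => by rw [mul_comm (x ^ 2)]; exact hx k) _)
    (by simpa using he 0) (he 1) (he 2) (he 3)
    (by simpa using hd 0) (hd 1) (hd 2) (hd 3) (wellPoisedCoeff_succ hq n)
    (hA x)
    (by rw [show x * q ^ 2 = x * q * q by ring]; exact hA (x * q))
    (hB (x ^ 2))
    (by
      have := hB (x ^ 2 * q ^ 2)
      rwa [show x ^ 2 * q ^ 2 * q = x ^ 2 * q ^ 3 by ring,
        show x ^ 2 * q ^ 2 * q ^ 2 = x ^ 2 * q ^ 4 by ring,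
        show x ^ 2 * q ^ 2 * q ^ 3 = x ^ 2 * q ^ 5 by ring] at this)
  have e0 : halfTerm x q n = wellPoisedCoeff q n * (1 - x * (q ^ (n + 1)) ^ 2) *
      qPoch (x * q) q n / qPoch (x ^ 2 * q) q (2 * (n + 1)) * x ^ (2 * (n + 1)) := by
    rw [halfTerm, mul_comm q (x ^ 2)]; ring
  have e1 : halfTerm (x * q) q n = wellPoisedCoeff q n * (1 - x * q * (q ^ (n + 1)) ^ 2) *
      qPoch (x * q * q) q n / qPoch (x ^ 2 * q ^ 3) q (2 * (n + 1)) *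
        (x ^ (2 * (n + 1)) * (q ^ (n + 1)) ^ 2) := by
    rw [halfTerm, show q * (x * q) ^ 2 = x ^ 2 * q ^ 3 by ring]; ring
  have e2 : halfTerm (x * q ^ 2) q n = wellPoisedCoeff q n *
      (1 - x * q ^ 2 * (q ^ (n + 1)) ^ 2) *
      qPoch (x * q ^ 2 * q) q n / qPoch (x ^ 2 * q ^ 5) q (2 * (n + 1)) *
        (x ^ (2 * (n + 1)) * (q ^ (n + 1)) ^ 4) := by
    rw [halfTerm, show q * (x * q ^ 2) ^ 2 = x ^ 2 * q ^ 5 by ring]; ring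
  rw [e0, e1, e2, key, halfCert, halfCert, show 2 * (n + 1 + 1) + 2 = 2 * (n + 1) + 1 + 1 + 1 + 1 by ring,
    qPoch_succ _ _ (2 * (n + 1) + 1 + 1 + 1), qPoch_succ _ _ (2 * (n + 1) + 1 + 1),
    qPoch_succ _ _ (2 * (n + 1) + 1), qPoch_succ _ _ (2 * (n + 1)), qPoch_succ (x * q) q n,
    mul_comm q (x ^ 2)]
  congr 1
  · congr 1 <;> ring
  · congr 1; ring

/-- Makes the telescoped sum collapse to its initial boundary term. The polynomial in q^(n+1) stays
bounded, and the rest decays like a quadratic power of q. -/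
theorem tendsto_halfCert {x q : ℂ} (hq : ‖q‖ < 1) (hx : ∀ k : ℕ, q * x ^ 2 * q ^ k ≠ 1) :
    Tendsto (halfCert x q) atTop (𝓝 0) := by
  obtain ⟨m, hm, h⟩ := exists_pos_le_norm_one_sub hq hx
  have hQ : Tendsto (fun n : ℕ => q ^ (n + 1)) atTop (𝓝 0) :=
    (tendsto_pow_atTop_nhds_zero_of_norm_lt_one hq).comp (tendsto_add_atTop_nat 1)
  have hpoly : Continuous fun Q : ℂ => (1 - Q) * (-1 + (x ^ 2 * q - 1) * Q
      + (x + x ^ 2 * q + x ^ 2 * q ^ 2 - x ^ 3 * q) * Q ^ 2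
      + (x ^ 5 * q ^ 4 - x ^ 3 * q ^ 3) * Q ^ 3 - x ^ 6 * q ^ 4 * Q ^ 4) := by fun_prop
  have hmain : Tendsto (fun n => wellPoisedCoeff q n * x ^ (2 * (n + 1)) * qPoch (x * q) q n
      / qPoch (q * x ^ 2) q (2 * (n + 1) + 2)) atTop (𝓝 0) := by
    have hs := (summable_pow_mul_pow (K := 2 * (1 + ‖x‖) * ‖x‖ ^ 2 / m ^ 2) (by positivity)
      (norm_nonneg q) hq le_triangle).mul_left (‖x‖ ^ 2 / m ^ 4)
    refine squeeze_zero_norm (fun n => ?_) hs.tendsto_atTop_zero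
    rw [norm_div, norm_mul, norm_mul, norm_pow]
    have h2 : ‖qPoch (x * q) q n‖ ≤ (1 + ‖x‖) ^ n := by
      refine (norm_qPoch_le _ hq n).trans ?_
      gcongr
      rw [norm_mul]
      exact mul_le_of_le_one_right (norm_nonneg _) hq.le
    calc _ ≤ 2 ^ n * ‖q‖ ^ ((n + 1) * (n + 2) / 2) * ‖x‖ ^ (2 * (n + 1)) * (1 + ‖x‖) ^ n
          / m ^ (2 * (n + 1) + 2) := by
          gcongr
          · exact norm_wellPoisedCoeff_le hq n
          · exact le_norm_qPoch hm.le h _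
      _ = _ := by
          rw [div_pow, mul_pow, mul_pow, ← pow_mul, ← pow_mul, mul_add 2 n 1, pow_add, pow_add,
            pow_add, mul_one]
          field_simp
  have := hmain.mul ((hpoly.tendsto 0).comp hQ)
  rw [zero_mul] at this
  refine this.congr fun n => ?_
  simp only [Function.comp, halfCert]
  ring

theorem neg_halfCert_zero (x : ℂ) {q : ℂ} (hq : ‖q‖ < 1) : -halfCert x q 0 =
    -(-q * x ^ 2 * (1 - q) * (-1 + (x ^ 2 * q - 1) * q
      + (x + x ^ 2 * q + x ^ 2 * q ^ 2 - x ^ 3 * q) * q ^ 2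
      + (x ^ 5 * q ^ 4 - x ^ 3 * q ^ 3) * q ^ 3 - x ^ 6 * q ^ 4 * q ^ 4)) /
    ((1 - x ^ 2 * q) * (1 - x ^ 2 * q ^ 2) * (1 - x ^ 2 * q ^ 3) * (1 - x ^ 2 * q ^ 4)) := by
  have h1 : qPoch q q 1 ≠ 0 := qPoch_self_ne_zero hq 1
  have hc : wellPoisedCoeff q 0 = -q := by
    rw [wellPoisedCoeff]
    field_simp
    norm_num
  rw [neg_div, halfCert, hc, qPoch_zero]
  simp only [zero_add, pow_one, mul_one]
  congr 2
  simp only [qPoch, Finset.prod_range_succ, Finset.prod_range_zero]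
  ring

/-- Naming the four inverses turns the partial fraction identity into a linear combination of their
defining relations. -/
theorem neg_halfCert_zero_aux {x q i₁ i₂ i₃ i₄ : ℂ} (k₁ : (1 - x ^ 2 * q) * i₁ = 1)
    (k₂ : (1 - x ^ 2 * q ^ 2) * i₂ = 1) (k₃ : (1 - x ^ 2 * q ^ 3) * i₃ = 1)
    (k₄ : (1 - x ^ 2 * q ^ 4) * i₄ = 1) :
    (-(x ^ 2 * q) * i₁ + x ^ 3 * q ^ 3 * i₂ - 1 + x * q
        + x * q * (-(x ^ 2 * q ^ 3) * i₃ + (x * q) ^ 3 * q ^ 3 * i₄ - 1 + x * q * q) + 1) *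
      ((1 - x ^ 2 * q) * (1 - x ^ 2 * q ^ 2) * (1 - x ^ 2 * q ^ 3) * (1 - x ^ 2 * q ^ 4)) =
    -(-q * x ^ 2 * (1 - q) * (-1 + (x ^ 2 * q - 1) * q
      + (x + x ^ 2 * q + x ^ 2 * q ^ 2 - x ^ 3 * q) * q ^ 2
      + (x ^ 5 * q ^ 4 - x ^ 3 * q ^ 3) * q ^ 3 - x ^ 6 * q ^ 4 * q ^ 4)) := by
  linear_combination
    -(x ^ 2 * q) * (1 - x ^ 2 * q ^ 2) * (1 - x ^ 2 * q ^ 3) * (1 - x ^ 2 * q ^ 4) * k₁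
    + x ^ 3 * q ^ 3 * (1 - x ^ 2 * q) * (1 - x ^ 2 * q ^ 3) * (1 - x ^ 2 * q ^ 4) * k₂
    - x ^ 3 * q ^ 4 * (1 - x ^ 2 * q) * (1 - x ^ 2 * q ^ 2) * (1 - x ^ 2 * q ^ 4) * k₃
    + x ^ 4 * q ^ 7 * (1 - x ^ 2 * q) * (1 - x ^ 2 * q ^ 2) * (1 - x ^ 2 * q ^ 3) * k₄

theorem tsum_halfTerm_recurrence {x q : ℂ} (hq : ‖q‖ < 1) (hx : ∀ k : ℕ, q * x ^ 2 * q ^ k ≠ 1) :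
    (∑' n, halfTerm x q n) - (1 - x * q) * (∑' n, halfTerm (x * q) q n)
      - x * q * (∑' n, halfTerm (x * q ^ 2) q n) = -halfCert x q 0 := by
  have h0 := (summable_norm_halfTerm hq hx).of_norm.hasSum
  have h1 := (summable_norm_halfTerm hq (by simpa using shift_ne_one hx 1)).of_norm.hasSum
  have h2 := (summable_norm_halfTerm hq (shift_ne_one hx 2)).of_norm.hasSum
  have hs := ((h0.sub (h1.mul_left (1 - x * q))).sub (h2.mul_left (x * q))).tendsto_sum_nat
  refine tendsto_nhds_unique hs ?_
  simp only [halfTerm_recurrence hq hx, Finset.sum_range_sub]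
  simpa using (tendsto_halfCert hq hx).sub_const (halfCert x q 0)

/-- The boundary term has the form r(x) + xq r(xq) + 1 with r rational. Since the partial theta
function θ satisfies θ(x) + xq θ(xq) = 1, r + θ solves the recurrence of S(x) - S(xq). -/
theorem neg_halfCert_zero_eq {x q : ℂ} (hq : ‖q‖ < 1) (hx : ∀ k : ℕ, q * x ^ 2 * q ^ k ≠ 1) :
    -(x ^ 2 * q) / (1 - x ^ 2 * q) + x ^ 3 * q ^ 3 / (1 - x ^ 2 * q ^ 2) - 1 + x * q
      + x * q * (-((x * q) ^ 2 * q) / (1 - (x * q) ^ 2 * q)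
        + (x * q) ^ 3 * q ^ 3 / (1 - (x * q) ^ 2 * q ^ 2) - 1 + x * q * q) + 1
      = -halfCert x q 0 := by
  have d1 : 1 - x ^ 2 * q ≠ 0 := by simpa using one_sub_sq_mul_pow_ne_zero hx 0
  have d2 : 1 - x ^ 2 * q ^ 2 ≠ 0 := one_sub_sq_mul_pow_ne_zero hx 1
  have d3 : 1 - x ^ 2 * q ^ 3 ≠ 0 := one_sub_sq_mul_pow_ne_zero hx 2
  have d4 : 1 - x ^ 2 * q ^ 4 ≠ 0 := one_sub_sq_mul_pow_ne_zero hx 3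
  have key := eq_div_of_mul_eq (mul_ne_zero (mul_ne_zero (mul_ne_zero d1 d2) d3) d4)
    (neg_halfCert_zero_aux (mul_inv_cancel₀ d1) (mul_inv_cancel₀ d2) (mul_inv_cancel₀ d3)
      (mul_inv_cancel₀ d4))
  rw [neg_halfCert_zero x hq, ← key, show (x * q) ^ 2 * q = x ^ 2 * q ^ 3 by ring,
    show (x * q) ^ 2 * q ^ 2 = x ^ 2 * q ^ 4 by ring]
  simp only [div_eq_mul_inv]

/-! ### The partial theta function and the first difference of the series -/

/-- The partial theta function `∑ (-x)^j q^(j(j+1)/2)`. -/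
noncomputable def partialTheta (x q : ℂ) : ℂ := ∑' j : ℕ, (-x) ^ j * q ^ (j * (j + 1) / 2)

theorem le_triangle' (N : ℕ) : ∀ᶠ n in atTop, N * n ≤ n * (n + 1) / 2 := by
  filter_upwards [eventually_ge_atTop (2 * N)] with n hn
  rw [Nat.le_div_iff_mul_le two_pos]
  nlinarith

theorem summable_partialTheta (x : ℂ) {q : ℂ} (hq : ‖q‖ < 1) :
    Summable fun j : ℕ => (-x) ^ j * q ^ (j * (j + 1) / 2) := by
  refine Summable.of_norm ?_
  simp only [norm_mul, norm_pow, norm_neg]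
  exact summable_pow_mul_pow (norm_nonneg x) (norm_nonneg q) hq le_triangle'

theorem partialTheta_eq_one_add (x : ℂ) {q : ℂ} (hq : ‖q‖ < 1) :
    partialTheta x q = 1 + ∑' j : ℕ, (-x) ^ (j + 1) * q ^ ((j + 1) * (j + 2) / 2) := by
  rw [partialTheta, (summable_partialTheta x hq).tsum_eq_zero_add]
  simp

theorem partialTheta_eq (x : ℂ) {q : ℂ} (hq : ‖q‖ < 1) :
    partialTheta x q = 1 - x * q * partialTheta (x * q) q := by
  rw [partialTheta_eq_one_add x hq, partialTheta, ← tsum_mul_left, sub_eq_add_neg, ← tsum_neg]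
  congr 1
  refine tsum_congr fun j => ?_
  rw [triangle_succ]
  ring

theorem tendsto_partialTheta {q : ℂ} (hq : ‖q‖ < 1) :
    Tendsto (fun y => partialTheta y q) (𝓝 0) (𝓝 1) := by
  have h : Tendsto (fun y : ℂ => ∑' j : ℕ, (-y) ^ (j + 1) * q ^ ((j + 1) * (j + 2) / 2))
      (𝓝 0) (𝓝 0) := by
    refine tendsto_tsum_nhds_zero
      (summable_pow_mul_pow (K := 1) zero_le_one (norm_nonneg q) hq le_triangle) ?_
    intro n y hy
    rw [norm_mul, norm_pow, norm_pow, norm_neg, one_pow, one_mul, pow_succ']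
    gcongr
    exact mul_le_of_le_one_right (norm_nonneg _) (pow_le_one₀ (norm_nonneg _) (by linarith))
  simpa [partialTheta_eq_one_add _ hq] using h.const_add 1

theorem partialTheta_sub_neg (x : ℂ) {q : ℂ} (hq : ‖q‖ < 1) :
    partialTheta x q - partialTheta (-x) q =
      -2 * ∑' n : ℕ, q ^ ((2 * n + 1) * (n + 1)) * x ^ (2 * n + 1) := by
  have hsplit : ∀ z : ℂ, partialTheta z q =
      (∑' k : ℕ, z ^ (2 * k) * q ^ (k * (2 * k + 1)))
        - ∑' k : ℕ, q ^ ((2 * k + 1) * (k + 1)) * z ^ (2 * k + 1) := fun z => by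
    have hs := summable_partialTheta z hq
    have he := hs.comp_injective (i := fun k : ℕ => 2 * k) fun a b h => by simpa using h
    have ho := hs.comp_injective (i := fun k : ℕ => 2 * k + 1) fun a b h => by simpa using h
    have h := tsum_even_add_odd (f := fun j : ℕ => (-z) ^ j * q ^ (j * (j + 1) / 2)) he ho
    rw [partialTheta, ← h, sub_eq_add_neg, ← tsum_neg]
    congr 1
    · refine tsum_congr fun k => ?_
      rw [show 2 * k * (2 * k + 1) = k * (2 * k + 1) * 2 by ring, Nat.mul_div_cancel _ two_pos,
        (even_two_mul k).neg_pow]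
    · refine tsum_congr fun k => ?_
      rw [show (2 * k + 1) * (2 * k + 1 + 1) = (2 * k + 1) * (k + 1) * 2 by ring,
        Nat.mul_div_cancel _ two_pos, Odd.neg_pow ⟨k, rfl⟩]
      ring
  rw [hsplit x, hsplit (-x)]
  simp only [(even_two_mul _).neg_pow, Odd.neg_pow ⟨_, rfl⟩, mul_neg, tsum_neg]
  ring

/-- Both sides satisfy the same first order equation, so their difference E obeys E(x) = -xq E(xq).
As xq^N tends to 0 this makes |E(xq^N)| eventually increasing in N, while its limit is 0. -/
theorem tsum_halfTerm_sub_shift {x q : ℂ} (hq : ‖q‖ < 1)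
    (hx : ∀ k : ℕ, q * x ^ 2 * q ^ k ≠ 1) :
    (∑' n, halfTerm x q n) - ∑' n, halfTerm (x * q) q n =
      -(x ^ 2 * q) / (1 - x ^ 2 * q) + x ^ 3 * q ^ 3 / (1 - x ^ 2 * q ^ 2) - 1 + x * q
        + partialTheta x q := by
  set E : ℂ → ℂ := fun x => (∑' n, halfTerm x q n) - (∑' n, halfTerm (x * q) q n) -
      (-(x ^ 2 * q) / (1 - x ^ 2 * q) + x ^ 3 * q ^ 3 / (1 - x ^ 2 * q ^ 2) - 1 + x * q
        + partialTheta x q) with hE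
  have hrec : ∀ x : ℂ, (∀ k : ℕ, q * x ^ 2 * q ^ k ≠ 1) → E x = -(x * q) * E (x * q) := by
    intro x hx
    have h1 := tsum_halfTerm_recurrence hq hx
    have h2 := partialTheta_eq x hq
    have h3 : -(x ^ 2 * q) / (1 - x ^ 2 * q) + x ^ 3 * q ^ 3 / (1 - x ^ 2 * q ^ 2) - 1 + x * q
        + x * q * (-((x * q) ^ 2 * q) / (1 - (x * q) ^ 2 * q)
          + (x * q) ^ 3 * q ^ 3 / (1 - (x * q) ^ 2 * q ^ 2) - 1 + x * q * q) + 1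
        = -halfCert x q 0 :=
      neg_halfCert_zero_eq hq hx
    have h4 : x * q ^ 2 = x * q * q := by ring
    rw [h4] at h1
    simp only [hE]
    linear_combination h1 - h3 - h2
  have hlim : Tendsto (fun N : ℕ => E (x * q ^ N)) atTop (𝓝 0) := by
    have ht := tendsto_pow_mul_zero x hq
    have ht' : Tendsto (fun N : ℕ => x * q ^ N * q) atTop (𝓝 0) := by simpa using ht.mul_const q
    -- The rational part tends to -1, which cancels the limit 1 of the partial theta function.
    have hr : Tendsto (fun x : ℂ => -(x ^ 2 * q) / (1 - x ^ 2 * q)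
        + x ^ 3 * q ^ 3 / (1 - x ^ 2 * q ^ 2) - 1 + x * q) (𝓝 0) (𝓝 (-1)) := by
      have : ContinuousAt (fun x : ℂ => -(x ^ 2 * q) / (1 - x ^ 2 * q)
        + x ^ 3 * q ^ 3 / (1 - x ^ 2 * q ^ 2) - 1 + x * q) 0 := by
        fun_prop (disch := simp)
      simpa [ContinuousAt] using this
    have := (((tendsto_tsum_halfTerm hq).comp ht).sub ((tendsto_tsum_halfTerm hq).comp ht')).sub
      ((hr.add (tendsto_partialTheta hq)).comp ht)
    simpa [hE, Function.comp_def] using this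
  have hrec' : ∀ N : ℕ, E (x * q ^ N) = -(x * q ^ (N + 1)) * E (x * q ^ (N + 1)) := fun N => by
    rw [hrec _ (shift_ne_one hx N), pow_succ, mul_assoc]
  have h0 : E (x * q ^ 0) = 0 := by
    refine eq_zero_of_norm_le_succ (e := fun N => E (x * q ^ N)) hlim ?_ fun N h => ?_
    · have hs : Tendsto (fun N : ℕ => ‖x * q ^ (N + 1)‖) atTop (𝓝 0) := by
        simpa using ((tendsto_pow_mul_zero x hq).comp (tendsto_add_atTop_nat 1)).norm
      filter_upwards [hs.eventually (gt_mem_nhds one_pos)] with N hN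
      rw [hrec' N, norm_mul, norm_neg]
      exact mul_le_of_le_one_left (norm_nonneg _) hN.le
    · rw [hrec' N, h, mul_zero]
  rw [pow_zero, mul_one] at h0
  exact sub_eq_zero.1 h0

/-! ### Bilateral and Lambert series, and the odd part of the well-poised series -/

/-- The term `x q^(n+1) / (1 - x² q^(2(n+1)))` of one half of the bilateral series. -/
noncomputable def bilateralTerm (x q : ℂ) (n : ℕ) : ℂ :=
  x * q ^ (n + 1) / (1 - x ^ 2 * q ^ (2 * (n + 1)))

/-- The term of the one-variable Lambert-type series. -/
noncomputable def lambertHalfTerm (x q : ℂ) (n : ℕ) : ℂ :=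
  q ^ ((2 * n + 1) * (n + 1)) / (1 - q ^ (2 * n + 1)) * x ^ (2 * n + 1)

theorem norm_bilateralTerm_le {x q : ℂ} {n : ℕ} (h : ‖x ^ 2 * q ^ (2 * (n + 1))‖ ≤ 1 / 2) :
    ‖bilateralTerm x q n‖ ≤ ‖x‖ * (2 * ‖q‖ ^ (n + 1)) := by
  have h1 : 1 / 2 ≤ ‖1 - x ^ 2 * q ^ (2 * (n + 1))‖ := by
    have := norm_sub_norm_le 1 (x ^ 2 * q ^ (2 * (n + 1)))
    rw [norm_one] at this
    linarith
  rw [bilateralTerm, norm_div, norm_mul, norm_pow, div_le_iff₀ (by linarith)]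
  have : 0 ≤ ‖x‖ * ‖q‖ ^ (n + 1) := by positivity
  nlinarith

theorem summable_geometric_succ {q : ℂ} (hq : ‖q‖ < 1) (c : ℝ) :
    Summable fun n : ℕ => c * ‖q‖ ^ (n + 1) :=
  (((summable_nat_add_iff 1).2 (summable_geometric_of_lt_one (norm_nonneg q) hq))).mul_left c

theorem exists_norm_sq_mul_pow_le (R : ℝ) {q : ℂ} (hq : ‖q‖ < 1) :
    ∃ N : ℕ, ∀ n ≥ N, ∀ x : ℂ, ‖x‖ ≤ R → ‖x ^ 2 * q ^ (2 * (n + 1))‖ ≤ 1 / 2 := by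
  have ht : Tendsto (fun n : ℕ => R ^ 2 * ‖q‖ ^ n) atTop (𝓝 0) := by
    simpa using (tendsto_pow_atTop_nhds_zero_of_lt_one (norm_nonneg q) hq).const_mul (R ^ 2)
  obtain ⟨N, hN⟩ := eventually_atTop.1
    (ht.eventually (gt_mem_nhds (show (0 : ℝ) < 1 / 2 by norm_num)))
  refine ⟨N, fun n hn x hx => ?_⟩
  rw [norm_mul, norm_pow, norm_pow]
  refine le_trans ?_ (hN _ (show N ≤ 2 * (n + 1) by omega)).le
  gcongr

/-- No condition on x is needed: denominators can vanish only at finitely many indices, where the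
term is 0 by convention. -/
theorem summable_bilateralTerm (x : ℂ) {q : ℂ} (hq : ‖q‖ < 1) : Summable (bilateralTerm x q) := by
  obtain ⟨N, hN⟩ := exists_norm_sq_mul_pow_le ‖x‖ hq
  refine Summable.of_norm_bounded_eventually_nat ((summable_geometric_succ hq 2).mul_left ‖x‖) ?_
  filter_upwards [eventually_ge_atTop N] with n hn
  exact norm_bilateralTerm_le (hN n hn x le_rfl)

theorem tsum_bilateralTerm_eq (x : ℂ) {q : ℂ} (hq : ‖q‖ < 1) :
    ∑' n, bilateralTerm x q n =
      x * q / (1 - x ^ 2 * q ^ 2) + ∑' n, bilateralTerm (x * q) q n := by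
  rw [(summable_bilateralTerm x hq).tsum_eq_zero_add]
  congr 1
  · simp [bilateralTerm]
  · refine tsum_congr fun n => ?_
    rw [bilateralTerm, bilateralTerm]
    congr 1 <;> ring

theorem tendsto_tsum_bilateralTerm {q : ℂ} (hq : ‖q‖ < 1) :
    Tendsto (fun y => ∑' n, bilateralTerm y q n) (𝓝 0) (𝓝 0) := by
  refine tendsto_tsum_nhds_zero (summable_geometric_succ hq 2) fun n y hy => ?_
  refine norm_bilateralTerm_le ?_
  rw [norm_mul, norm_pow, norm_pow]
  have h1 : ‖q‖ ^ (2 * (n + 1)) ≤ 1 := pow_le_one₀ (norm_nonneg _) hq.le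
  have h2 : ‖y‖ ^ 2 ≤ 1 / 2 := by nlinarith [norm_nonneg y]
  calc _ ≤ 1 / 2 * (1 : ℝ) := by gcongr
    _ = 1 / 2 := mul_one _

theorem norm_lambertHalfTerm_le (x : ℂ) {q : ℂ} (hq : ‖q‖ < 1) (n : ℕ) :
    ‖lambertHalfTerm x q n‖ ≤
      ‖x‖ * ((1 - ‖q‖)⁻¹ * ((‖x‖ ^ 2) ^ n * ‖q‖ ^ ((2 * n + 1) * (n + 1)))) := by
  have h0 : 0 < 1 - ‖q‖ := by linarith
  have h1 : 1 - ‖q‖ ≤ ‖1 - q ^ (2 * n + 1)‖ := by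
    have := norm_sub_norm_le 1 (q ^ (2 * n + 1))
    rw [norm_one, norm_pow] at this
    have h2 : ‖q‖ ^ (2 * n + 1) ≤ ‖q‖ := pow_le_of_le_one (norm_nonneg _) hq.le (by omega)
    linarith
  rw [lambertHalfTerm, norm_mul, norm_div, norm_pow, norm_pow]
  calc _ ≤ ‖q‖ ^ ((2 * n + 1) * (n + 1)) / (1 - ‖q‖) * ‖x‖ ^ (2 * n + 1) := by gcongr
    _ = _ := by rw [← pow_mul, pow_succ ‖x‖ (2 * n)]; ring

theorem le_odd_triangle (N : ℕ) : ∀ᶠ n in atTop, N * n ≤ (2 * n + 1) * (n + 1) := by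
  filter_upwards [eventually_ge_atTop N] with n hn
  nlinarith

theorem summable_lambertHalfTerm (x : ℂ) {q : ℂ} (hq : ‖q‖ < 1) :
    Summable (lambertHalfTerm x q) :=
  Summable.of_norm_bounded (((summable_pow_mul_pow (by positivity) (norm_nonneg q) hq
    le_odd_triangle).mul_left _).mul_left _) (norm_lambertHalfTerm_le x hq)

/-- The shift multiplies the n-th term by q^(2n+1), so the difference cancels the Lambert
denominator and leaves an odd partial theta series. -/
theorem tsum_lambertHalfTerm_sub_shift (x : ℂ) {q : ℂ} (hq : ‖q‖ < 1) :
    (∑' n, lambertHalfTerm x q n) - ∑' n, lambertHalfTerm (x * q) q n =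
      ∑' n : ℕ, q ^ ((2 * n + 1) * (n + 1)) * x ^ (2 * n + 1) := by
  rw [← (summable_lambertHalfTerm x hq).tsum_sub (summable_lambertHalfTerm (x * q) hq)]
  refine tsum_congr fun n => ?_
  have h : 1 - q ^ (2 * n + 1) ≠ 0 := sub_ne_zero.2 (pow_succ_ne_one hq (2 * n)).symm
  rw [lambertHalfTerm, lambertHalfTerm, mul_pow]
  field_simp

theorem tendsto_tsum_lambertHalfTerm {q : ℂ} (hq : ‖q‖ < 1) :
    Tendsto (fun y => ∑' n, lambertHalfTerm y q n) (𝓝 0) (𝓝 0) := by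
  refine tendsto_tsum_nhds_zero ((summable_pow_mul_pow (K := 1) zero_le_one (norm_nonneg q) hq
    le_odd_triangle).mul_left (1 - ‖q‖)⁻¹) fun n y hy => ?_
  refine (norm_lambertHalfTerm_le y hq n).trans ?_
  have h0 : 0 ≤ (1 - ‖q‖)⁻¹ := inv_nonneg.2 (by linarith)
  have h1 : ‖y‖ ^ 2 ≤ 1 := pow_le_one₀ (norm_nonneg _) (by linarith)
  gcongr

/-- The odd part of the one-variable well-poised series, as a difference of Lambert series. -/
theorem tsum_halfTerm_sub_neg {x q : ℂ} (hq : ‖q‖ < 1) (hx : ∀ k : ℕ, q * x ^ 2 * q ^ k ≠ 1) :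
    (∑' n, halfTerm x q n) - ∑' n, halfTerm (-x) q n =
      2 * ((∑' n, bilateralTerm x q n) - ∑' n, lambertHalfTerm x q n) := by
  set D : ℂ → ℂ := fun x => (∑' n, halfTerm x q n) - (∑' n, halfTerm (-x) q n) -
    2 * ((∑' n, bilateralTerm x q n) - ∑' n, lambertHalfTerm x q n) with hD
  -- In the odd part of the shift difference of S, the rational part is twice xq / (1 - x²q²), the
  -- shift difference of the bilateral series (`h6`), and the theta part is -2 times that of the
  -- Lambert series.
  have hstep : ∀ x : ℂ, (∀ k : ℕ, q * x ^ 2 * q ^ k ≠ 1) → D x = D (x * q) := by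
    intro x hx
    have h1 := tsum_halfTerm_sub_shift hq hx
    have h2 := tsum_halfTerm_sub_shift (x := -x) hq (by simpa using hx)
    have h3 := tsum_bilateralTerm_eq x hq
    have h4 := tsum_lambertHalfTerm_sub_shift x hq
    have h5 := partialTheta_sub_neg x hq
    have h6 : x ^ 3 * q ^ 3 / (1 - x ^ 2 * q ^ 2) + x * q = x * q / (1 - x ^ 2 * q ^ 2) := by
      have := one_sub_sq_mul_pow_ne_zero hx 1
      norm_num at this
      field_simp
      ring
    have h7 : (-x) ^ 3 * q ^ 3 / (1 - (-x) ^ 2 * q ^ 2) =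
        -(x ^ 3 * q ^ 3 / (1 - x ^ 2 * q ^ 2)) := by
      rw [even_two.neg_pow, Odd.neg_pow (by decide)]; ring
    rw [h7, even_two.neg_pow, neg_mul x q] at h2
    simp only [hD]
    linear_combination h1 - h2 - 2 * h3 + 2 * h4 + h5 + 2 * h6
  have hstepN : ∀ N : ℕ, D (x * q ^ N) = D x := by
    intro N
    induction N with
    | zero => simp
    | succ N ih => rw [← ih, hstep _ (shift_ne_one hx N), pow_succ, mul_assoc]
  have hlim : Tendsto D (𝓝 0) (𝓝 0) := by
    have hneg : Tendsto (fun y : ℂ => -y) (𝓝 0) (𝓝 0) := by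
      simpa using (continuous_neg (G := ℂ)).tendsto 0
    have := ((tendsto_tsum_halfTerm hq).sub ((tendsto_tsum_halfTerm hq).comp hneg)).sub
      (((tendsto_tsum_bilateralTerm hq).sub (tendsto_tsum_lambertHalfTerm hq)).const_mul 2)
    simpa [hD, Function.comp_def] using this
  have h0 : D x = 0 := by
    refine tendsto_nhds_unique ?_ (hlim.comp (tendsto_pow_mul_zero x hq))
    simp [Function.comp_def, hstepN]
  exact sub_eq_zero.1 h0

/-! ### Infinite products and theta functions -/

theorem qPochInf_eq_one_sub_mul (x : ℂ) {q : ℂ} (hq : ‖q‖ < 1) :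
    qPochInf x q = (1 - x) * qPochInf (x * q) q := by
  refine tendsto_nhds_unique
    ((tendsto_qPoch_qPochInf x hq).comp (tendsto_add_atTop_nat 1)) ?_
  refine ((tendsto_qPoch_qPochInf (x * q) hq).const_mul (1 - x)).congr fun n => ?_
  exact (qPoch_succ_left x q n).symm

theorem qPochInf_one {q : ℂ} (hq : ‖q‖ < 1) : qPochInf 1 q = 0 := by
  rw [qPochInf_eq_one_sub_mul 1 hq, sub_self, zero_mul]

theorem norm_sq_lt_one {q : ℂ} (hq : ‖q‖ < 1) : ‖q ^ 2‖ < 1 := by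
  rw [norm_pow]; exact pow_lt_one₀ (norm_nonneg _) hq two_ne_zero

theorem qPochInf_mul_neg (x : ℂ) {q : ℂ} (hq : ‖q‖ < 1) :
    qPochInf x q * qPochInf (-x) q = qPochInf (x ^ 2) (q ^ 2) := by
  refine tendsto_nhds_unique
    ((tendsto_qPoch_qPochInf x hq).mul (tendsto_qPoch_qPochInf (-x) hq)) ?_
  refine (tendsto_qPoch_qPochInf (x ^ 2) (norm_sq_lt_one hq)).congr fun n => ?_
  rw [qPoch, qPoch, qPoch, ← Finset.prod_mul_distrib]
  exact Finset.prod_congr rfl fun k _ => by ring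

theorem qPochInf_ne_zero {x q : ℂ} (hq : ‖q‖ < 1) (h : ∀ k : ℕ, x * q ^ k ≠ 1) :
    qPochInf x q ≠ 0 := by
  have := tprod_one_add_ne_zero_of_summable (f := fun k : ℕ => -(x * q ^ k))
    (fun k => by rw [← sub_eq_add_neg]; exact sub_ne_zero.2 (h k).symm)
    (by simpa using (summable_geometric_of_lt_one (norm_nonneg q) hq).mul_left ‖x‖)
  simpa only [qPochInf, sub_eq_add_neg] using this

theorem differentiable_qPochInf {q : ℂ} (hq : ‖q‖ < 1) :
    Differentiable ℂ fun x => qPochInf x q := by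
  intro x
  have hp := Summable.hasProdLocallyUniformlyOn_nat_one_add (f := fun (k : ℕ) (y : ℂ) => -(y * q ^ k))
    (K := Metric.ball 0 (‖x‖ + 1)) (u := fun k => (‖x‖ + 1) * ‖q‖ ^ k) Metric.isOpen_ball
    ((summable_geometric_of_lt_one (norm_nonneg q) hq).mul_left _)
    (Eventually.of_forall fun k y hy => by
      rw [mem_ball_zero_iff] at hy
      rw [norm_neg, norm_mul, norm_pow]
      gcongr)
    (fun k => by fun_prop)
  have hd : DifferentiableOn ℂ (fun y => ∏' k : ℕ, (1 + -(y * q ^ k)))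
      (Metric.ball 0 (‖x‖ + 1)) :=
    hp.differentiableOn (Eventually.of_forall fun _ => by
      simpa [Finset.prod_fn] using DifferentiableOn.finsetProd (fun _ _ => by fun_prop))
      Metric.isOpen_ball
  have := hd.differentiableAt (Metric.isOpen_ball.mem_nhds (show x ∈ _ by simp))
  simpa only [qPochInf, sub_eq_add_neg] using this

theorem analyticAt_qPochInf {q : ℂ} (hq : ‖q‖ < 1) {g : ℂ → ℂ} {z : ℂ} (hg : AnalyticAt ℂ g z) :
    AnalyticAt ℂ (fun x => qPochInf (g x) q) z :=
  ((differentiable_qPochInf hq).analyticAt (g z)).comp hg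

/-- The theta function `(x, q/x; q)_∞`. -/
noncomputable def qTheta (x q : ℂ) : ℂ := qPochInf x q * qPochInf (q / x) q

theorem qTheta_mul {x q : ℂ} (hq : ‖q‖ < 1) (hq0 : q ≠ 0) (hx : x ≠ 0) :
    qTheta (x * q) q = -x⁻¹ * qTheta x q := by
  rw [qTheta, qTheta, qPochInf_eq_one_sub_mul x hq,
    show q / (x * q) = x⁻¹ by field_simp, qPochInf_eq_one_sub_mul x⁻¹ hq,
    show x⁻¹ * q = q / x by ring]
  field_simp
  ring

theorem qTheta_mul_neg (x : ℂ) {q : ℂ} (hq : ‖q‖ < 1) :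
    qTheta x q * qTheta (-x) q = qTheta (x ^ 2) (q ^ 2) := by
  rw [qTheta, qTheta, qTheta, ← qPochInf_mul_neg x hq, ← div_pow, ← qPochInf_mul_neg (q / x) hq,
    div_neg]
  ring

theorem qTheta_ne_zero {x q : ℂ} (hq : ‖q‖ < 1)
    (h : ∀ n : ℤ, x * q ^ n ≠ 1) : qTheta x q ≠ 0 := by
  refine mul_ne_zero (qPochInf_ne_zero hq fun k => by simpa using h k)
    (qPochInf_ne_zero hq fun k hk => h (-(k + 1 : ℕ)) ?_)
  have hx : x ≠ 0 := by
    rintro rfl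
    simp at hk
  have : q ^ (k + 1) = x := by
    field_simp at hk
    rw [pow_succ', hk]
  rw [zpow_neg, zpow_natCast, this, mul_inv_cancel₀ hx]

theorem analyticAt_qTheta {q : ℂ} (hq : ‖q‖ < 1) {g : ℂ → ℂ} {z : ℂ} (hg : AnalyticAt ℂ g z)
    (h0 : g z ≠ 0) : AnalyticAt ℂ (fun x => qTheta (g x) q) z :=
  (analyticAt_qPochInf hq hg).mul (analyticAt_qPochInf hq (analyticAt_const.div hg h0))

/-- On the ball of radius ‖x‖ + 1 only finitely many terms can have poles; the tail is dominated
there by a geometric series. -/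
theorem analyticAt_tsum_bilateralTerm {x q : ℂ} (hq : ‖q‖ < 1)
    (hx : ∀ n : ℕ, x ^ 2 * q ^ (2 * (n + 1)) ≠ 1) :
    AnalyticAt ℂ (fun y => ∑' n, bilateralTerm y q n) x := by
  obtain ⟨N, hN⟩ := exists_norm_sq_mul_pow_le (‖x‖ + 1) hq
  have heq : (fun y => ∑' n, bilateralTerm y q n) = fun y =>
      (∑ n ∈ Finset.range N, bilateralTerm y q n) + ∑' n, bilateralTerm y q (n + N) := by
    funext y
    exact ((summable_bilateralTerm y hq).sum_add_tsum_nat_add N).symm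
  rw [heq]
  refine AnalyticAt.add ?_ ?_
  · refine Finset.analyticAt_fun_sum _ fun n _ => ?_
    have := sub_ne_zero.2 (hx n).symm
    unfold bilateralTerm
    fun_prop (disch := assumption)
  · have hd : DifferentiableOn ℂ (fun y => ∑' n, bilateralTerm y q (n + N))
        (Metric.ball 0 (‖x‖ + 1)) := by
      refine Complex.differentiableOn_tsum_of_summable_norm
        (u := fun n => (‖x‖ + 1) * (2 * ‖q‖ ^ (n + N + 1))) ?_ ?_ Metric.isOpen_ball ?_
      · exact ((summable_nat_add_iff N).2 (summable_geometric_succ hq 2)).mul_left _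
      · intro n y hy
        rw [mem_ball_zero_iff] at hy
        have h1 := hN (n + N) (by omega) y hy.le
        have h2 : 1 - y ^ 2 * q ^ (2 * (n + N + 1)) ≠ 0 := by
          refine sub_ne_zero.2 fun h => ?_
          rw [← h, norm_one] at h1
          norm_num at h1
        refine DifferentiableAt.differentiableWithinAt ?_
        unfold bilateralTerm
        fun_prop (disch := assumption)
      · intro n y hy
        rw [mem_ball_zero_iff] at hy
        refine (norm_bilateralTerm_le (hN (n + N) (by omega) y hy.le)).trans ?_
        gcongr
    exact hd.analyticAt (Metric.isOpen_ball.mem_nhds (by simp))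

/-! ### Removable singularities and q-invariant functions -/

/-- A function that agrees near every point of `s`, apart from the point, with a function analytic
there has an analytic extension to `s`. -/
theorem exists_analyticAt_extension {f : ℂ → ℂ} {s : Set ℂ}
    (h : ∀ a ∈ s, ∃ g : ℂ → ℂ, AnalyticAt ℂ g a ∧ f =ᶠ[𝓝[≠] a] g) (hs : IsOpen s) :
    ∃ F : ℂ → ℂ, ∀ a ∈ s, AnalyticAt ℂ F a ∧ f =ᶠ[𝓝[≠] a] F := by
  choose! g hg hfg using h
  -- Each local extension `g b` takes at b the limit of `f` there. The diagonal function is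
  -- therefore independent of choices and agrees with `g a` near a.
  have key : ∀ a ∈ s, (fun b => g b b) =ᶠ[𝓝 a] g a := by
    intro a ha
    have h1 : ∀ᶠ b in 𝓝[≠] a, f =ᶠ[𝓝 b] g a := by
      have := eventually_eventually_nhdsWithin.2 (hfg a ha)
      filter_upwards [this, self_mem_nhdsWithin] with b hb hba
      rwa [isOpen_compl_singleton.nhdsWithin_eq hba] at hb
    have h2 : ∀ᶠ b in 𝓝[≠] a, AnalyticAt ℂ (g a) b :=
      (hg a ha).eventually_analyticAt.filter_mono nhdsWithin_le_nhds
    have h3 : ∀ᶠ b in 𝓝[≠] a, b ∈ s := (hs.mem_nhds ha |> mem_nhdsWithin_of_mem_nhds)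
    have h4 : ∀ᶠ b in 𝓝[≠] a, g b b = g a b := by
      filter_upwards [h1, h2, h3] with b hb1 hb2 hb3
      have e : g b =ᶠ[𝓝[≠] b] g a :=
        (hfg b hb3).symm.trans (hb1.filter_mono nhdsWithin_le_nhds)
      exact tendsto_nhds_unique_of_eventuallyEq
        ((hg b hb3).continuousAt.tendsto.mono_left nhdsWithin_le_nhds)
        (hb2.continuousAt.tendsto.mono_left nhdsWithin_le_nhds) e
    rw [eventually_nhdsWithin_iff] at h4
    filter_upwards [h4] with b hb
    by_cases hba : b = a
    · rw [hba]
    · exact hb hba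
  refine ⟨fun b => g b b, fun a ha => ⟨(hg a ha).congr (key a ha).symm, ?_⟩⟩
  exact (hfg a ha).trans ((key a ha).symm.filter_mono nhdsWithin_le_nhds)

theorem exists_zpow_mem_annulus {q : ℂ} (hq : ‖q‖ < 1) (hq0 : q ≠ 0) {a : ℂ} (ha : a ≠ 0) :
    ∃ k : ℤ, ‖q‖ < ‖a * q ^ k‖ ∧ ‖a * q ^ k‖ ≤ 1 := by
  have hr := norm_pos_iff.2 hq0
  obtain ⟨n, hn1, hn2⟩ := exists_mem_Ioc_zpow (norm_pos_iff.2 ha) ((one_lt_inv₀ hr).2 hq)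
  refine ⟨n + 1, ?_, ?_⟩
  · rw [norm_mul, norm_zpow]
    rw [inv_zpow] at hn1
    rw [zpow_add_one₀ hr.ne', ← mul_assoc]
    refine lt_mul_of_one_lt_left hr ?_
    rwa [inv_lt_iff_one_lt_mul₀ (zpow_pos hr n)] at hn1
  · rw [norm_mul, norm_zpow]
    rw [inv_zpow] at hn2
    have hp := zpow_pos hr (n + 1)
    calc ‖a‖ * ‖q‖ ^ (n + 1) ≤ (‖q‖ ^ (n + 1))⁻¹ * ‖q‖ ^ (n + 1) := by gcongr
      _ = 1 := inv_mul_cancel₀ hp.ne'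

theorem apply_mul_zpow_of_mul_invariant {q : ℂ} (hq0 : q ≠ 0) {F : ℂ → ℂ}
    (hinv : ∀ a ≠ 0, F (a * q) = F a) (k : ℤ) : ∀ a ≠ 0, F (a * q ^ k) = F a := by
  induction k with
  | zero => simp
  | succ k ih =>
    intro a ha
    rw [zpow_add_one₀ hq0, ← mul_assoc, hinv _ (mul_ne_zero ha (zpow_ne_zero _ hq0)), ih a ha]
  | pred k ih =>
    intro a ha
    rw [← hinv _ (mul_ne_zero ha (zpow_ne_zero _ hq0)), mul_assoc, ← zpow_add_one₀ hq0,
      sub_add_cancel, ih a ha]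

/-- A function on `ℂ \ {0}` that is analytic and invariant under `z ↦ z q` is constant. -/
theorem eq_of_mul_invariant {q : ℂ} (hq : ‖q‖ < 1) (hq0 : q ≠ 0) {F : ℂ → ℂ}
    (hF : ∀ a ≠ 0, AnalyticAt ℂ F a) (hinv : ∀ a ≠ 0, F (a * q) = F a) {a b : ℂ} (ha : a ≠ 0)
    (hb : b ≠ 0) : F a = F b := by
  have hz := apply_mul_zpow_of_mul_invariant hq0 hinv
  -- The pullback under exp is entire. By invariance its values are those taken on the compact
  -- annulus ‖q‖ ≤ ‖a‖ ≤ 1, so it is bounded and Liouville applies.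
  have hdiff : Differentiable ℂ fun z => F (Complex.exp z) := fun z =>
    (hF _ (Complex.exp_ne_zero z)).differentiableAt.comp z Complex.differentiableAt_exp
  have hcomp : IsCompact {a : ℂ | ‖q‖ ≤ ‖a‖ ∧ ‖a‖ ≤ 1} := by
    refine (isCompact_closedBall (0 : ℂ) 1).of_isClosed_subset ?_ fun a ha => by simpa using ha.2
    exact (isClosed_le continuous_const continuous_norm).inter
      (isClosed_le continuous_norm continuous_const)
  have hcont : ContinuousOn F {a : ℂ | ‖q‖ ≤ ‖a‖ ∧ ‖a‖ ≤ 1} := fun a ha =>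
    (hF a (norm_pos_iff.1 ((norm_pos_iff.2 hq0).trans_le ha.1))).continuousAt.continuousWithinAt
  have hbd : Bornology.IsBounded (Set.range fun z => F (Complex.exp z)) := by
    refine (hcomp.image_of_continuousOn hcont).isBounded.subset ?_
    rintro _ ⟨z, rfl⟩
    obtain ⟨k, hk1, hk2⟩ := exists_zpow_mem_annulus hq hq0 (Complex.exp_ne_zero z)
    exact ⟨_, ⟨hk1.le, hk2⟩, hz k _ (Complex.exp_ne_zero z)⟩
  have := hdiff.apply_eq_apply_of_bounded hbd (Complex.log a) (Complex.log b)
  simpa [Complex.exp_log ha, Complex.exp_log hb] using this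

/-! ### Partial fractions of the theta quotient -/

/-- The bilateral series `∑ x q^n / (1 - x² q^(2n))` over all integers, folded onto `n ≥ 0`. -/
noncomputable def bilateralSum (x q : ℂ) : ℂ :=
  x / (1 - x ^ 2) + (∑' n, bilateralTerm x q n) - ∑' n, bilateralTerm (1 / x) q n

/-- The elliptic theta quotient with simple poles at the points `±q^n`. -/
noncomputable def thetaQuotient (a b q : ℂ) : ℂ :=
  a * (qTheta (b / a) q * qTheta (-a * b) q * qPochInf (q ^ 2) (q ^ 2) ^ 2) /
    (qTheta (a ^ 2) (q ^ 2) * qTheta (b ^ 2) (q ^ 2))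

theorem bilateralSum_mul {x q : ℂ} (hq : ‖q‖ < 1) (hq0 : q ≠ 0) (hx : x ≠ 0) :
    bilateralSum (x * q) q = bilateralSum x q := by
  have h1 := tsum_bilateralTerm_eq x hq
  have h2 := tsum_bilateralTerm_eq (1 / (x * q)) hq
  have h3 : 1 / (x * q) * q = 1 / x := by field_simp
  have h4 : (1 / (x * q)) ^ 2 * q ^ 2 = 1 / x ^ 2 := by field_simp
  have h5 : 1 / x / (1 - 1 / x ^ 2) = -(x / (1 - x ^ 2)) := by
    -- At x² = 1 both sides are divisions by 0, hence 0, so invariance holds even at poles.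
    by_cases h : 1 - x ^ 2 = 0
    · have : x ^ 2 = 1 := (sub_eq_zero.1 h).symm
      simp [this]
    · have h' : x ^ 2 - 1 ≠ 0 := fun h0 => h (by linear_combination -h0)
      rw [show 1 - 1 / x ^ 2 = (x ^ 2 - 1) / x ^ 2 by field_simp]
      rw [show 1 - x ^ 2 = -(x ^ 2 - 1) by ring, div_neg, neg_neg]
      field_simp
  rw [h3, h4, h5] at h2
  rw [bilateralSum, bilateralSum, h2, h1]
  ring

/-- The multiplier of the numerator is q · (-b/(aq)) · 1/(ab) = -1/a², the same as that of the
denominator. -/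
theorem thetaQuotient_mul {a b q : ℂ} (hq : ‖q‖ < 1) (hq0 : q ≠ 0) (ha : a ≠ 0) (hb : b ≠ 0) :
    thetaQuotient (a * q) b q = thetaQuotient a b q := by
  have h1 : qTheta (b / (a * q)) q = -(b / (a * q)) * qTheta (b / a) q := by
    have := qTheta_mul hq hq0 (x := b / (a * q)) (by positivity)
    rw [show b / (a * q) * q = b / a by field_simp] at this
    rw [this]
    field_simp
  have h2 : qTheta (-(a * q) * b) q = (a * b)⁻¹ * qTheta (-a * b) q := by
    have := qTheta_mul hq hq0 (x := -a * b) (mul_ne_zero (neg_ne_zero.2 ha) hb)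
    rw [show -(a * q) * b = -a * b * q by ring, this]
    rw [show -(-a * b)⁻¹ = (a * b)⁻¹ by rw [neg_mul, inv_neg, neg_neg]]
  have h3 : qTheta ((a * q) ^ 2) (q ^ 2) = -(a ^ 2)⁻¹ * qTheta (a ^ 2) (q ^ 2) := by
    rw [mul_pow]
    exact qTheta_mul (norm_sq_lt_one hq) (pow_ne_zero 2 hq0) (pow_ne_zero 2 ha)
  rw [thetaQuotient, thetaQuotient, h1, h2, h3,
    ← mul_div_mul_left _ (qTheta (a ^ 2) (q ^ 2) * qTheta (b ^ 2) (q ^ 2))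
      (neg_ne_zero.2 (inv_ne_zero (pow_ne_zero 2 ha)))]
  congr 1
  · field_simp
  · ring

/-- Isolates 1 - a², the only a-dependent factor of the denominator that can vanish on the annulus
‖q‖ < ‖a‖ ≤ 1. -/
theorem thetaQuotient_eq (a b : ℂ) {q : ℂ} (hq : ‖q‖ < 1) :
    thetaQuotient a b q = a * (qTheta (b / a) q * qTheta (-a * b) q * qPochInf (q ^ 2) (q ^ 2) ^ 2) /
      (qPochInf (a ^ 2 * q ^ 2) (q ^ 2) * qPochInf (q ^ 2 / a ^ 2) (q ^ 2) *
        qTheta (b ^ 2) (q ^ 2)) / (1 - a ^ 2) := by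
  have h : qTheta (a ^ 2) (q ^ 2) =
      (1 - a ^ 2) * qPochInf (a ^ 2 * q ^ 2) (q ^ 2) * qPochInf (q ^ 2 / a ^ 2) (q ^ 2) := by
    rw [qTheta, qPochInf_eq_one_sub_mul (a ^ 2) (norm_sq_lt_one hq)]
  rw [thetaQuotient, h, div_div]
  congr 1
  ring

theorem exists_analyticAt_div_one_sub_sq {W : ℂ → ℂ} {a : ℂ} (hW : AnalyticAt ℂ W a)
    (ha : a ^ 2 = 1 → W a = 0) :
    ∃ g : ℂ → ℂ, AnalyticAt ℂ g a ∧ (fun z => W z / (1 - z ^ 2)) =ᶠ[𝓝[≠] a] g := by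
  by_cases h : a ^ 2 = 1
  · have ha0 : a ≠ 0 := by rintro rfl; norm_num at h
    have haa : a + a ≠ 0 := by rw [← two_mul]; exact mul_ne_zero two_ne_zero ha0
    obtain ⟨p, hp⟩ := hW
    refine ⟨fun z => -dslope W a z / (z + a), ?_, ?_⟩
    · exact hp.has_fpower_series_dslope_fslope.analyticAt.neg.div
        (analyticAt_id.add analyticAt_const) haa
    · filter_upwards [self_mem_nhdsWithin] with z hz
      have hza : z - a ≠ 0 := sub_ne_zero.2 hz
      rw [dslope_of_ne _ hz, slope_def_field, ha h, sub_zero,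
        show 1 - z ^ 2 = -((z - a) * (z + a)) by rw [← h]; ring, div_neg, neg_div, div_div]
  · have h' : 1 - a ^ 2 ≠ 0 := sub_ne_zero.2 (Ne.symm h)
    exact ⟨_, hW.div (analyticAt_const.sub (analyticAt_id.pow 2)) h', EventuallyEq.rfl⟩

/-- Partial fraction expansion of the elliptic theta quotient. -/
theorem thetaQuotient_eq_bilateralSum_sub {a b q : ℂ} (hq : ‖q‖ < 1) (hq0 : q ≠ 0) (ha : a ≠ 0)
    (hb : b ≠ 0) (haq : ∀ n : ℤ, a ^ 2 * q ^ n ≠ 1) (hbq : ∀ n : ℤ, b ^ 2 * q ^ n ≠ 1) :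
    thetaQuotient a b q = bilateralSum a q - bilateralSum b q := by
  have hr := norm_pos_iff.2 hq0
  have hq2 := norm_sq_lt_one hq
  have hbT : qTheta (b ^ 2) (q ^ 2) ≠ 0 := qTheta_ne_zero hq2 fun n => by
    have := hbq (2 * n)
    rwa [zpow_mul, zpow_ofNat] at this
  have hPq : qPochInf (q ^ 2) (q ^ 2) ≠ 0 := qPochInf_ne_zero hq2 fun k => by
    rw [← pow_succ']; exact pow_succ_ne_one hq2 k
  set V : ℂ → ℂ := fun z =>
    z * (qTheta (b / z) q * qTheta (-z * b) q * qPochInf (q ^ 2) (q ^ 2) ^ 2) /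
      (qPochInf (z ^ 2 * q ^ 2) (q ^ 2) * qPochInf (q ^ 2 / z ^ 2) (q ^ 2) *
        qTheta (b ^ 2) (q ^ 2)) with hV
  -- Equality of the residues at ±1: there the two theta factors in the numerator multiply to
  -- `qTheta (b ^ 2) (q ^ 2)` and the squared product cancels, so `V z = z`.
  have hV1 : ∀ z : ℂ, z ^ 2 = 1 → z - V z = 0 := by
    intro z hz
    have hz' : z = 1 ∨ z = -1 := mul_self_eq_one_iff.1 (by rw [← sq]; exact hz)
    have hprod : qTheta (b / z) q * qTheta (-z * b) q = qTheta (b ^ 2) (q ^ 2) := by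
      rcases hz' with rfl | rfl
      · rw [← qTheta_mul_neg b hq, div_one, neg_one_mul]
      · rw [← qTheta_mul_neg b hq, div_neg, div_one, neg_neg, one_mul, mul_comm]
    simp only [hV]
    rw [hprod, hz, one_mul, div_one]
    field_simp
    ring
  set f : ℂ → ℂ := fun z => bilateralSum z q - bilateralSum b q - thetaQuotient z b q with hf
  have hfinv : ∀ z ≠ 0, f (z * q) = f z := fun z hz => by
    simp only [hf, bilateralSum_mul hq hq0 hz, thetaQuotient_mul hq hq0 hz hb]
  have hfz := apply_mul_zpow_of_mul_invariant hq0 hfinv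
  -- On the fundamental annulus the only possible poles come from (z - V z) / (1 - z²), and these
  -- are removable.
  have hannulus : ∀ c : ℂ, ‖q‖ < ‖c‖ → ‖c‖ ≤ 1 →
      ∃ g : ℂ → ℂ, AnalyticAt ℂ g c ∧ f =ᶠ[𝓝[≠] c] g := by
    intro c hc1 hc2
    have hc0 : c ≠ 0 := norm_pos_iff.1 (hr.trans hc1)
    have hsmall : ∀ u : ℂ, ‖u‖ < 1 → ∀ k : ℕ, u * (q ^ 2) ^ k ≠ 1 := fun u hu k h => by
      have h1 : ‖u * (q ^ 2) ^ k‖ ≤ ‖u‖ := by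
        rw [norm_mul, norm_pow]
        exact mul_le_of_le_one_right (norm_nonneg _) (pow_le_one₀ (norm_nonneg _) hq2.le)
      rw [h, norm_one] at h1
      linarith
    have hu1 : ‖c ^ 2 * q ^ 2‖ < 1 := by
      rw [norm_mul, norm_pow c]
      exact mul_lt_one_of_nonneg_of_lt_one_right (pow_le_one₀ (norm_nonneg _) hc2)
        (norm_nonneg _) hq2
    have hu2 : ‖q ^ 2 / c ^ 2‖ < 1 := by
      rw [← div_pow, norm_pow, norm_div]
      exact pow_lt_one₀ (by positivity) ((div_lt_one (hr.trans hc1)).2 hc1) two_ne_zero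
    have hVan : AnalyticAt ℂ V c := by
      have hid : AnalyticAt ℂ (fun z : ℂ => z) c := analyticAt_id
      refine AnalyticAt.div ?_ ?_ ?_
      · refine hid.mul (((analyticAt_qTheta hq (analyticAt_const.div hid hc0)
          (div_ne_zero hb hc0)).mul (analyticAt_qTheta hq (hid.neg.mul analyticAt_const)
          (mul_ne_zero (neg_ne_zero.2 hc0) hb))).mul analyticAt_const)
      · exact ((analyticAt_qPochInf hq2 ((hid.pow 2).mul analyticAt_const)).mul
          (analyticAt_qPochInf hq2 (analyticAt_const.div (hid.pow 2) (pow_ne_zero 2 hc0)))).mul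
          analyticAt_const
      · exact mul_ne_zero (mul_ne_zero (qPochInf_ne_zero hq2 (hsmall _ hu1))
          (qPochInf_ne_zero hq2 (hsmall _ hu2))) hbT
    obtain ⟨g, hg, hgW⟩ := exists_analyticAt_div_one_sub_sq (W := fun z => z - V z)
      (analyticAt_id.sub hVan) (hV1 c)
    have hB1 : AnalyticAt ℂ (fun y => ∑' n, bilateralTerm y q n) c :=
      analyticAt_tsum_bilateralTerm hq fun n h => hsmall _ hu1 n <| by rw [← h]; ring
    have hB2 : AnalyticAt ℂ (fun y => ∑' n, bilateralTerm (1 / y) q n) c :=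
      AnalyticAt.comp (g := fun y => ∑' n, bilateralTerm y q n) (f := fun y => 1 / y)
        (analyticAt_tsum_bilateralTerm hq fun n h => hsmall _ hu2 n <| by rw [← h]; ring)
        (analyticAt_const.div analyticAt_id hc0)
    refine ⟨fun z => g z + (∑' n, bilateralTerm z q n) - (∑' n, bilateralTerm (1 / z) q n)
      - bilateralSum b q, ((hg.add hB1).sub hB2).sub analyticAt_const, ?_⟩
    filter_upwards [hgW] with z hz
    rw [← hz]
    simp only [hf, thetaQuotient_eq z b hq, bilateralSum, hV]
    ring
  -- Invariance of `f` carries the local extension from the annulus to every nonzero point.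
  have hlocal : ∀ c ∈ ({0}ᶜ : Set ℂ), ∃ g : ℂ → ℂ, AnalyticAt ℂ g c ∧ f =ᶠ[𝓝[≠] c] g := by
    intro c hc
    obtain ⟨k, hk1, hk2⟩ := exists_zpow_mem_annulus hq hq0 hc
    obtain ⟨g, hg, hfg⟩ := hannulus _ hk1 hk2
    have hqk : q ^ k ≠ 0 := zpow_ne_zero k hq0
    refine ⟨fun z => g (z * q ^ k), ?_, ?_⟩
    · exact AnalyticAt.comp (g := g) (f := fun z => z * q ^ k) hg
        (analyticAt_id.mul analyticAt_const)
    · have ht : Tendsto (fun z : ℂ => z * q ^ k) (𝓝[≠] c) (𝓝[≠] (c * q ^ k)) := by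
        refine tendsto_nhdsWithin_iff.2 ⟨?_, ?_⟩
        · exact ((continuous_mul_const (q ^ k)).tendsto c).mono_left nhdsWithin_le_nhds
        · filter_upwards [self_mem_nhdsWithin] with z hz h
          exact hz (mul_right_cancel₀ hqk h)
      have hne : ∀ᶠ z in 𝓝[≠] c, z ≠ 0 :=
        mem_nhdsWithin_of_mem_nhds (isOpen_ne.mem_nhds hc)
      filter_upwards [ht.eventually hfg, hne] with z hz hz0
      rw [← hz, hfz k z hz0]
  obtain ⟨F, hF⟩ := exists_analyticAt_extension hlocal isOpen_compl_singleton
  have hFinv : ∀ c ≠ 0, F (c * q) = F c := by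
    intro c hc
    have hcq : c * q ≠ 0 := mul_ne_zero hc hq0
    have ht : Tendsto (fun z : ℂ => z * q) (𝓝[≠] c) (𝓝[≠] (c * q)) := by
      refine tendsto_nhdsWithin_iff.2 ⟨?_, ?_⟩
      · exact ((continuous_mul_const q).tendsto c).mono_left nhdsWithin_le_nhds
      · filter_upwards [self_mem_nhdsWithin] with z hz h
        exact hz (mul_right_cancel₀ hq0 h)
    have hne : ∀ᶠ z in 𝓝[≠] c, z ≠ 0 := mem_nhdsWithin_of_mem_nhds (isOpen_ne.mem_nhds hc)
    refine tendsto_nhds_unique_of_eventuallyEq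
      (((hF _ hcq).1.continuousAt.tendsto.mono_left nhdsWithin_le_nhds).comp ht)
      ((hF c hc).1.continuousAt.tendsto.mono_left nhdsWithin_le_nhds) ?_
    filter_upwards [ht.eventually (hF _ hcq).2, (hF c hc).2, hne] with z h1 h2 h3
    rw [Function.comp_apply, ← h1, ← h2, hfinv z h3]
  -- Away from the poles `f` is itself continuous, so the extension takes the same value there and
  -- not merely nearby.
  have hregular : ∀ c : ℂ, c ≠ 0 → (∀ n : ℤ, c ^ 2 * q ^ n ≠ 1) → F c = f c := by
    intro c hc hcq
    have hcT : qTheta (c ^ 2) (q ^ 2) ≠ 0 := qTheta_ne_zero hq2 fun n => by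
      have := hcq (2 * n)
      rwa [zpow_mul, zpow_ofNat] at this
    have hid : AnalyticAt ℂ (fun z : ℂ => z) c := analyticAt_id
    have hB1 : AnalyticAt ℂ (fun y => ∑' n, bilateralTerm y q n) c :=
      analyticAt_tsum_bilateralTerm hq fun n h => hcq (2 * (n + 1) : ℕ) <| by
        rw [zpow_natCast]; exact h
    have hB2 : AnalyticAt ℂ (fun y => ∑' n, bilateralTerm (1 / y) q n) c :=
      AnalyticAt.comp (g := fun y => ∑' n, bilateralTerm y q n) (f := fun y => 1 / y)
        (analyticAt_tsum_bilateralTerm hq fun n h => hcq (-(2 * (n + 1) : ℕ)) <| by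
          rw [zpow_neg, zpow_natCast]
          rw [one_div, inv_pow] at h
          rw [← inv_inj, mul_inv, inv_inv, h, inv_one])
        (analyticAt_const.div analyticAt_id hc)
    have h1 : (1 : ℂ) - c ^ 2 ≠ 0 := sub_ne_zero.2 (by simpa using (hcq 0).symm)
    have hfc : AnalyticAt ℂ f c := by
      refine AnalyticAt.sub (AnalyticAt.sub (((hid.div (analyticAt_const.sub (hid.pow 2)) h1).add
        hB1).sub hB2) analyticAt_const) ?_
      exact (hid.mul (((analyticAt_qTheta hq (analyticAt_const.div hid hc)
          (div_ne_zero hb hc)).mul (analyticAt_qTheta hq (hid.neg.mul analyticAt_const)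
          (mul_ne_zero (neg_ne_zero.2 hc) hb))).mul analyticAt_const)).div
        ((analyticAt_qTheta hq2 (hid.pow 2) (pow_ne_zero 2 hc)).mul analyticAt_const)
        (mul_ne_zero hcT hbT)
    exact tendsto_nhds_unique_of_eventuallyEq
      ((hF c hc).1.continuousAt.tendsto.mono_left nhdsWithin_le_nhds)
      (hfc.continuousAt.tendsto.mono_left nhdsWithin_le_nhds) (hF c hc).2.symm
  -- At z = b the factor `qTheta (b / z) q` contains (1; q)_∞ = 0.
  have hfb : f b = 0 := by
    simp only [hf, thetaQuotient, sub_self, div_self hb, qTheta, qPochInf_one hq]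
    simp
  have hfa : f a = 0 := by
    rw [← hregular a ha haq, eq_of_mul_invariant hq hq0 (fun c hc => (hF c hc).1) hFinv ha hb,
      hregular b hb hbq, hfb]
  simp only [hf] at hfa
  linear_combination -hfa

/-! ### The case q = 0 and the final assembly -/

theorem bilateralSum_zero (x : ℂ) : bilateralSum x 0 = x / (1 - x ^ 2) := by
  simp [bilateralSum, bilateralTerm]

theorem qPochInf_zero_right (x : ℂ) : qPochInf x 0 = 1 - x := by
  refine tendsto_nhds_unique (tendsto_qPoch_qPochInf x (by simp)) ?_
  refine tendsto_const_nhds.congr' ?_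
  filter_upwards [eventually_ge_atTop 1] with n hn
  obtain ⟨m, rfl⟩ := Nat.exists_eq_add_of_le' hn
  rw [qPoch_succ_left]
  simp [qPoch]

theorem thetaQuotient_zero {a b : ℂ} (ha : a ≠ 0) (ha2 : a ^ 2 ≠ 1) (hb2 : b ^ 2 ≠ 1) :
    thetaQuotient a b 0 = bilateralSum a 0 - bilateralSum b 0 := by
  have h1 := sub_ne_zero.2 ha2.symm
  have h2 := sub_ne_zero.2 hb2.symm
  rw [bilateralSum_zero, bilateralSum_zero, thetaQuotient]
  simp only [qTheta, ne_eq, OfNat.ofNat_ne_zero, not_false_eq_true, zero_pow, zero_div,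
    qPochInf_zero_right]
  field_simp
  ring

theorem mul_sq_mul_pow_ne_one {x q : ℂ} (h : ∀ n : ℤ, x ^ 2 * q ^ n ≠ 1) (k : ℕ) :
    q * x ^ 2 * q ^ k ≠ 1 := by
  have := h (k + 1 : ℕ)
  rw [zpow_natCast] at this
  rwa [show q * x ^ 2 * q ^ k = x ^ 2 * q ^ (k + 1) by ring]

theorem div_sq_mul_zpow_ne_one {x q : ℂ} (h : ∀ n : ℤ, x ^ 2 * q ^ n ≠ 1) (n : ℤ) :
    (1 / x) ^ 2 * q ^ n ≠ 1 := by
  have := h (-n)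
  rwa [Ne, ← inv_inj, zpow_neg, mul_inv, inv_inv, inv_one, ← inv_pow, ← one_div] at this

/-- Since (x; q)_(n+1) / (1 - x) = (xq; q)_n, the apparent poles at x = ±1 in the stated series are
absent from `halfTerm`. -/
theorem halfTerm_sub_neg {x : ℂ} (q : ℂ) (h : x ^ 2 ≠ 1) (n : ℕ) :
    halfTerm x q n - halfTerm (-x) q n = wellPoisedCoeff q n *
      ((1 - x * q ^ (2 * (n + 1))) * qPoch x q (n + 1) /
          ((1 - x) * qPoch (q * x ^ 2) q (2 * (n + 1))) * x ^ (2 * (n + 1)) -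
        (1 + x * q ^ (2 * (n + 1))) * qPoch (-x) q (n + 1) /
          ((1 + x) * qPoch (q * x ^ 2) q (2 * (n + 1))) * x ^ (2 * (n + 1))) := by
  have key : ∀ y : ℂ, 1 - y ≠ 0 → halfTerm y q n = wellPoisedCoeff q n *
      ((1 - y * q ^ (2 * (n + 1))) * qPoch y q (n + 1) /
        ((1 - y) * qPoch (q * y ^ 2) q (2 * (n + 1))) * y ^ (2 * (n + 1))) := fun y hy => by
    rw [halfTerm, qPoch_succ_left y q n,
      show (1 - y * q ^ (2 * (n + 1))) * ((1 - y) * qPoch (y * q) q n) =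
        (1 - y) * ((1 - y * q ^ (2 * (n + 1))) * qPoch (y * q) q n) by ring,
      mul_div_mul_left _ _ hy]
    ring
  have h1 : 1 - x ≠ 0 := fun h0 => h (by rw [← sub_eq_zero.1 h0, one_pow])
  have h2 : 1 - -x ≠ 0 := fun h0 => h (by rw [← neg_sq, ← sub_eq_zero.1 h0, one_pow])
  rw [key x h1, key (-x) h2, neg_sq, (even_two_mul (n + 1)).neg_pow, neg_mul, sub_neg_eq_add,
    sub_neg_eq_add, mul_sub]

theorem one_div_sq_ne_one {x : ℂ} (h : x ^ 2 ≠ 1) : (1 / x) ^ 2 ≠ 1 := fun h0 => h <| by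
  rwa [one_div, inv_pow, inv_eq_one] at h0

theorem wellPoisedTerm_eq {a b : ℂ} (q : ℂ) (ha2 : a ^ 2 ≠ 1) (hb2 : b ^ 2 ≠ 1) (n : ℕ) :
    wellPoisedTerm a b q (n + 1) =
      (halfTerm a q n - halfTerm (-a) q n) - (halfTerm b q n - halfTerm (-b) q n)
      - (halfTerm (1 / a) q n - halfTerm (-(1 / a)) q n)
      + (halfTerm (1 / b) q n - halfTerm (-(1 / b)) q n) := by
  rw [halfTerm_sub_neg q ha2, halfTerm_sub_neg q hb2, halfTerm_sub_neg q (one_div_sq_ne_one ha2),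
    halfTerm_sub_neg q (one_div_sq_ne_one hb2), wellPoisedTerm]
  have hc : (-1) ^ (n + 1) * q ^ ((n + 1) * (n + 1 + 1) / 2) * qPoch q q (2 * (n + 1) - 1) /
      qPoch q q (n + 1) = wellPoisedCoeff q n := rfl
  rw [hc]
  have e1 : ∀ z : ℂ, q / z ^ 2 = q * (1 / z) ^ 2 := fun z => by rw [one_div, inv_pow]; rfl
  have e2 : ∀ z : ℂ, q ^ (2 * (n + 1)) / z = 1 / z * q ^ (2 * (n + 1)) := fun z => by
    rw [one_div, inv_mul_eq_div]
  have e3 : ∀ z : ℂ, -1 / z = -(1 / z) := fun z => neg_div z 1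
  have e4 : ∀ z : ℂ, 1 / z ^ (2 * (n + 1)) = (1 / z) ^ (2 * (n + 1)) := fun z => by
    rw [one_div, one_div, inv_pow]
  rw [e1, e1, e2, e2, e3, e3, e4, e4]
  ring

theorem lambertTerm_eq (a b q : ℂ) (n : ℕ) :
    lambertTerm a b q n = lambertHalfTerm b q n - lambertHalfTerm a q n
      + lambertHalfTerm (1 / a) q n - lambertHalfTerm (1 / b) q n := by
  simp only [lambertTerm, lambertHalfTerm, one_div, inv_pow]
  rw [show 2 * n ^ 2 + 3 * n + 1 = (2 * n + 1) * (n + 1) by ring]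
  ring

theorem corollary2 (a b q : ℂ) (hq : ‖q‖ < 1) (ha : a ≠ 0) (hb : b ≠ 0)
    (haq : ∀ n : ℤ, a ^ 2 * q ^ n ≠ 1) (hbq : ∀ n : ℤ, b ^ 2 * q ^ n ≠ 1) :
    Summable (fun n : ℕ => lambertTerm a b q n) ∧
    Summable (fun n : ℕ => wellPoisedTerm a b q (n + 1)) ∧
    (∑' n : ℕ, lambertTerm a b q n) - 1 / 2 * ∑' n : ℕ, wellPoisedTerm a b q (n + 1) =
      (a - b) * (1 + a * b) / ((1 - a ^ 2) * (1 - b ^ 2)) -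
        a * ((qPochInf (b / a) q * qPochInf (q * a / b) q * qPochInf (-a * b) q *
              qPochInf (-q / (a * b)) q * (qPochInf (q ^ 2) (q ^ 2) * qPochInf (q ^ 2) (q ^ 2))) /
            (qPochInf (a ^ 2) (q ^ 2) * qPochInf (q ^ 2 / a ^ 2) (q ^ 2) *
              qPochInf (b ^ 2) (q ^ 2) * qPochInf (q ^ 2 / b ^ 2) (q ^ 2))) := by
  have ha2 : a ^ 2 ≠ 1 := by simpa using haq 0
  have hb2 : b ^ 2 ≠ 1 := by simpa using hbq 0
  have rega := mul_sq_mul_pow_ne_one haq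
  have regb := mul_sq_mul_pow_ne_one hbq
  have rega' := mul_sq_mul_pow_ne_one (div_sq_mul_zpow_ne_one haq)
  have regb' := mul_sq_mul_pow_ne_one (div_sq_mul_zpow_ne_one hbq)
  have hL := (((summable_lambertHalfTerm b hq).hasSum.sub
    (summable_lambertHalfTerm a hq).hasSum).add
    (summable_lambertHalfTerm (1 / a) hq).hasSum).sub (summable_lambertHalfTerm (1 / b) hq).hasSum
  have hF : ∀ x : ℂ, (∀ k : ℕ, q * x ^ 2 * q ^ k ≠ 1) →
      HasSum (fun n => halfTerm x q n - halfTerm (-x) q n)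
        (2 * ((∑' n, bilateralTerm x q n) - ∑' n, lambertHalfTerm x q n)) := fun x hx => by
    rw [← tsum_halfTerm_sub_neg hq hx]
    exact (summable_norm_halfTerm hq hx).of_norm.hasSum.sub
      (summable_norm_halfTerm hq (by simpa using hx)).of_norm.hasSum
  have hW := (((hF a rega).sub (hF b regb)).sub (hF _ rega')).add (hF _ regb')
  simp only [← lambertTerm_eq] at hL
  simp only [← wellPoisedTerm_eq q ha2 hb2] at hW
  refine ⟨hL.summable, hW.summable, ?_⟩
  have hT : thetaQuotient a b q = bilateralSum a q - bilateralSum b q := by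
    rcases eq_or_ne q 0 with rfl | hq0
    · exact thetaQuotient_zero ha ha2 hb2
    · exact thetaQuotient_eq_bilateralSum_sub hq hq0 ha hb haq hbq
  have hR : a * ((qPochInf (b / a) q * qPochInf (q * a / b) q * qPochInf (-a * b) q *
      qPochInf (-q / (a * b)) q * (qPochInf (q ^ 2) (q ^ 2) * qPochInf (q ^ 2) (q ^ 2))) /
      (qPochInf (a ^ 2) (q ^ 2) * qPochInf (q ^ 2 / a ^ 2) (q ^ 2) *
        qPochInf (b ^ 2) (q ^ 2) * qPochInf (q ^ 2 / b ^ 2) (q ^ 2))) = thetaQuotient a b q := by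
    rw [← mul_div_assoc, thetaQuotient, qTheta, qTheta, qTheta, qTheta, show q / (b / a) = q * a / b by field_simp,
      show q / (-a * b) = -q / (a * b) by rw [neg_mul, div_neg, neg_div]]
    congr 1 <;> ring
  have hrat : (a - b) * (1 + a * b) / ((1 - a ^ 2) * (1 - b ^ 2)) =
      a / (1 - a ^ 2) - b / (1 - b ^ 2) := by
    have h1 := sub_ne_zero.2 ha2.symm
    have h2 := sub_ne_zero.2 hb2.symm
    field_simp
    ring
  -- The factor 1/2 absorbs the 2 in `hF`, the Lambert sums cancel, and the rational term accounts
  -- for the central terms x / (1 - x²) of the two bilateral sums.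
  rw [hR, hT, hrat, hL.tsum_eq, hW.tsum_eq, bilateralSum, bilateralSum]
  ring
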